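/- \textbf{Setting.} Let $\mathcal X$ be a set, $k:\mathcal X\times\mathcal X\to\mathbb R$ a scalar reproducing kernel (symmetric and positive semidefinite), $x_1,\dots,x_n\in\mathcal X$, $\mathcal Y\subseteq\mathbb R^T$, $y_1,\dots,y_n\in\mathcal Y$, and let $V:\mathcal Y\times\mathbb R^T\to\mathbb R_+$ be a loss function such that $V(y,\cdot)$ is convex for every $y\in\mathcal Y$. Let $\lambda>0$, $\epsilon>0$ and $\mu\in[0,1]$. Let $S_{++}^T$ be the set of symmetric positive definite real $T\times T$ matrices. For $A\in S_{++}^T$ let $\mathcal H_A$ be the reproducing kernel Hilbert space of functions $\mathcal X\to\mathbb R^T$ with matrix-valued kernel $\Gamma(x,x')=k(x,x')A$. The Sparse Kernel MTL problem is to minimize, over all pairs $(f,A)$ with $A\in S_{++}^T$ and $f\in\mathcal H_A$, $$S(f,A)=\frac1n\sum_{i=1}^n V(y_i,f(x_i))+\lambda\Big(\|f\|_{\mathcal H_A}^2+\epsilon\operatorname{tr}(A^{-1})+\mu\operatorname{tr}(A)+(1-\mu)\sum_{t,s=1}^T|A_{ts}|\Big).$$ Alternating minimization starts from $f_0=0$,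 $A_0=I_T$ and sets, for $i\ge 0$, $$f_{i+1}\in\operatorname*{argmin}_{f\in\mathcal H_{A_i}}S(f,A_i),\qquad A_{i+1}\in\operatorname*{argmin}_{A\in S_{++}^T,\ f_{i+1}\in\mathcal H_A}S(f_{i+1},A).$$ \textbf{Theorem (convergence of alternating minimization).} The Sparse Kernel MTL problem has exactly one solution $(f_*,A_*)$. There is exactly one sequence $(f_i,A_i)_{i\in\mathbb N}$ generated by alternating minimization. It is a minimizing sequence, i.e. every $(f_i,A_i)$ is feasible and $S(f_i,A_i)$ converges to the infimum of $S$ over the feasible set, and it converges to $(f_*,A_*)$: $A_i\to A_*$ in $\mathbb R^{T\times T}$, and, for every $A\in S_{++}^T$, all $f_i$ and $f_*$ lie in $\mathcal H_A$ and $f_i\to f_*$ in the norm of $\mathcal H_A$. -/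

import Mathlib

open Filter Topology

noncomputable section

namespace SparseKernelMTL

/-- The output space `ℝ^T` with its Euclidean inner product. -/
abbrev Out (T : ℕ) := EuclideanSpace ℝ (Fin T)

/-- Scalar reproducing kernels on `X`: symmetric functions `k : X × X → ℝ` all of whose finite
Gram matrices are positive semidefinite. -/
abbrev ScalarKernel (X : Type*) := {k : Matrix X X ℝ // k.PosSemidef}

/-- The set `S_{++}^T` of symmetric positive definite real `T × T` matrices, with the topology
induced by that of `ℝ^{T × T}`. -/
abbrev PDMatrix (T : ℕ) := {A : Matrix (Fin T) (Fin T) ℝ // A.PosDef}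

/-- The identity matrix `I_T`. -/
def PDMatrix.id (T : ℕ) : PDMatrix T := ⟨1, Matrix.PosDef.one⟩

/-- The separable matrix-valued kernel `Γ(x, x') = k(x, x') A`. -/
def separableKernel {X : Type*} {T : ℕ} (k : ScalarKernel X) (A : PDMatrix T) :
    Matrix X X (Out T →L[ℝ] Out T) :=
  Matrix.of fun x x' => k.1 x x' • Matrix.toEuclideanCLM (n := Fin T) (𝕜 := ℝ) A.1

theorem separableKernel_posSemidef {X : Type*} {T : ℕ} (k : ScalarKernel X) (A : PDMatrix T) :
    (separableKernel k A).PosSemidef := by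
  have h3 := (RKHS.posSemidef_tfae (K := separableKernel k A)).out 0 2
  refine h3.mpr (And.intro ?_ ?_)
  · ext1 x x'
    have hA : star (Matrix.toEuclideanCLM (n := Fin T) (𝕜 := ℝ) A.1)
        = Matrix.toEuclideanCLM (n := Fin T) (𝕜 := ℝ) A.1 := by
      rw [← map_star]
      congr 1
      exact A.2.isHermitian
    have hk : k.1 x' x = k.1 x x' := by simpa using k.2.isHermitian.apply x x'
    simp [separableKernel, Matrix.conjTranspose_apply, star_smul, hA, hk]
  · intro v
    obtain ⟨C, hC⟩ : ∃ C : Matrix (Fin T) (Fin T) ℝ, A.1 = C.conjTranspose * C := by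
      open scoped MatrixOrder in
      exact CStarAlgebra.nonneg_iff_eq_star_mul_self.mp A.2.posSemidef.nonneg
    have hin : ∀ (x x' : X) (w w' : Out T),
        inner ℝ (separableKernel k A x' x w) w'
          = ∑ t, (C.mulVec w.ofLp) t * k.1 x' x * (C.mulVec w'.ofLp) t := by
      intro x x' w w'
      simp only [separableKernel, Matrix.of_apply, smul_apply,
        real_inner_smul_left]
      rw [real_inner_comm, Matrix.inner_toEuclideanCLM, hC, ← Matrix.mulVec_mulVec,
        Matrix.dotProduct_mulVec, Matrix.conjTranspose_eq_transpose_of_trivial,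
        Matrix.vecMul_transpose, dotProduct, Finset.mul_sum]
      exact Finset.sum_congr rfl fun t _ => by ring
    simp only [hin, RCLike.re_to_real]
    simp only [Finsupp.sum]
    have : ∀ t : Fin T, 0 ≤ ∑ x ∈ v.support, ∑ x' ∈ v.support,
        (C.mulVec (v x).ofLp) t * k.1 x' x * (C.mulVec (v x').ofLp) t := by
      intro t
      have h := k.2.2 (v.mapRange (fun w => (C.mulVec w.ofLp) t) (by simp))
      rw [Finsupp.sum_of_support_subset _ Finsupp.support_mapRange _ (by simp)] at h
      have h' : ∀ i, (v.mapRange (fun w => (C.mulVec w.ofLp) t) (by simp)).sum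
          (fun j xj => star ((C.mulVec (v i).ofLp) t) * k.1 i j * xj)
          = ∑ j ∈ v.support, (C.mulVec (v i).ofLp) t * k.1 i j * (C.mulVec (v j).ofLp) t := by
        intro i
        rw [Finsupp.sum_of_support_subset _ Finsupp.support_mapRange _ (by simp)]
        simp
      simp only [Finsupp.mapRange_apply, h'] at h
      rw [Finset.sum_comm]
      refine h.trans_eq (Finset.sum_congr rfl fun i _ => Finset.sum_congr rfl fun j _ => by ring)
    calc (0 : ℝ) ≤ ∑ t, ∑ x ∈ v.support, ∑ x' ∈ v.support,
          (C.mulVec (v x).ofLp) t * k.1 x' x * (C.mulVec (v x').ofLp) t :=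
          Finset.sum_nonneg fun t _ => this t
      _ = _ := by
          rw [Finset.sum_comm]
          exact Finset.sum_congr rfl fun x _ => Finset.sum_comm

instance {X : Type*} {T : ℕ} (k : ScalarKernel X) (A : PDMatrix T) :
    Fact (separableKernel k A).PosSemidef := ⟨separableKernel_posSemidef k A⟩

/-- The reproducing kernel Hilbert space `H` of functions `X → ℝ^T` whose reproducing kernel is
the separable kernel `k A`. -/
def Hyp {X : Type*} {T : ℕ} (k : ScalarKernel X) (A : PDMatrix T) :=
  RKHS.OfKernel (separableKernel k A)

instance {X : Type*} {T : ℕ} (k : ScalarKernel X) (A : PDMatrix T) :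
    NormedAddCommGroup (Hyp k A) :=
  inferInstanceAs (NormedAddCommGroup (RKHS.OfKernel (separableKernel k A)))

instance {X : Type*} {T : ℕ} (k : ScalarKernel X) (A : PDMatrix T) :
    InnerProductSpace ℝ (Hyp k A) :=
  inferInstanceAs (InnerProductSpace ℝ (RKHS.OfKernel (separableKernel k A)))

instance {X : Type*} {T : ℕ} (k : ScalarKernel X) (A : PDMatrix T) :
    CompleteSpace (Hyp k A) :=
  inferInstanceAs (CompleteSpace (RKHS.OfKernel (separableKernel k A)))

instance {X : Type*} {T : ℕ} (k : ScalarKernel X) (A : PDMatrix T) :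
    RKHS ℝ (Hyp k A) X (Out T) :=
  inferInstanceAs (RKHS ℝ (RKHS.OfKernel (separableKernel k A)) X (Out T))

theorem kernel_hyp {X : Type*} {T : ℕ} (k : ScalarKernel X) (A : PDMatrix T) :
    RKHS.kernel (Hyp k A) = separableKernel k A :=
  RKHS.OfKernel.kernel_ofKernel (K := separableKernel k A)

/-- `f : X → ℝ^T` belongs to the space `H` with kernel `k A`. -/
def MemHyp {X : Type*} {T : ℕ} (k : ScalarKernel X) (A : PDMatrix T) (f : X → Out T) : Prop :=
  ∃ g : Hyp k A, ⇑g = f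

open Classical in
/-- The norm `‖f‖_H` of a function `f` in the space `H` with kernel `k A`: the norm of the (unique)
element of `H` whose underlying function is `f`. The value `0` outside `H` is never used. -/
def hypNorm {X : Type*} {T : ℕ} (k : ScalarKernel X) (A : PDMatrix T) (f : X → Out T) : ℝ :=
  if h : MemHyp k A f then ‖h.choose‖ else 0

theorem memHyp_coe {X : Type*} {T : ℕ} (k : ScalarKernel X) (A : PDMatrix T) (g : Hyp k A) :
    MemHyp k A ⇑g := ⟨g, rfl⟩

theorem hypNorm_coe {X : Type*} {T : ℕ} (k : ScalarKernel X) (A : PDMatrix T) (g : Hyp k A) :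
    hypNorm k A ⇑g = ‖g‖ := by
  rw [hypNorm, dif_pos (memHyp_coe k A g), DFunLike.coe_injective (memHyp_coe k A g).choose_spec]

/-- Convergence `f_i → f` in the norm of the space `H` with kernel `k A` (all functions being
elements of `H`). -/
def TendstoHyp {X : Type*} {T : ℕ} (k : ScalarKernel X) (A : PDMatrix T)
    (f : ℕ → X → Out T) (f' : X → Out T) : Prop :=
  ∃ (g : ℕ → Hyp k A) (g' : Hyp k A),
    (∀ i, ⇑(g i) = f i) ∧ ⇑g' = f' ∧ Tendsto g atTop (𝓝 g')

/-- The data of a Sparse Kernel MTL problem with `n` training points and `T` tasks. -/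
structure Problem (X : Type*) (n T : ℕ) where
  /-- the scalar reproducing kernel `k` -/
  k : ScalarKernel X
  /-- the set `𝒴 ⊆ ℝ^T` of admissible outputs -/
  Y : Set (Out T)
  /-- the loss function `V : 𝒴 × ℝ^T → ℝ₊` -/
  V : Y → Out T → ℝ
  /-- the training inputs `x_1, …, x_n` -/
  x : Fin n → X
  /-- the training outputs `y_1, …, y_n` -/
  y : Fin n → Y
  /-- the regularization parameter `λ` -/
  lam : ℝ
  /-- the regularization parameter `ε` -/
  eps : ℝ
  /-- the regularization parameter `μ` -/
  mu : ℝ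

namespace Problem

variable {X : Type*} {n T : ℕ} (P : Problem X n T)

/-- The feasible set: pairs `(f, A)` with `A ∈ S_{++}^T` and `f` in the space `H` with kernel
`k A`. -/
def feasible : Set ((X → Out T) × PDMatrix T) := {p | MemHyp P.k p.2 p.1}

/-- The objective functional
`S(f, A) = n⁻¹ ∑ᵢ V(yᵢ, f(xᵢ)) + λ (‖f‖_H² + ε tr(A⁻¹) + μ tr(A) + (1 - μ) ‖A‖_{ℓ₁})`,
where `H` is the space with kernel `k A`. -/
def objective (p : (X → Out T) × PDMatrix T) : ℝ :=
  (1 / (n : ℝ)) * ∑ i, P.V (P.y i) (p.1 (P.x i)) +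
    P.lam * (hypNorm P.k p.2 p.1 ^ 2 + P.eps * (p.2.1⁻¹).trace + P.mu * p.2.1.trace +
      (1 - P.mu) * ∑ t, ∑ s, |p.2.1 t s|)

/-- `p` is a solution (global minimizer over the feasible set) of the problem. -/
def IsSolution (p : (X → Out T) × PDMatrix T) : Prop :=
  p ∈ P.feasible ∧ IsMinOn P.objective P.feasible p

/-- Supervised step: `f` is a minimizer of `S(·, A)` over the space `H` with kernel `k A`. -/
def IsSupervisedStep (A : PDMatrix T) (f : X → Out T) : Prop :=
  (f, A) ∈ P.feasible ∧ ∀ g, (g, A) ∈ P.feasible → P.objective (f, A) ≤ P.objective (g, A)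

/-- Unsupervised step: `A` is a minimizer of `S(f, ·)` over the matrices in `S_{++}^T` for which
`(f, A)` is feasible. -/
def IsUnsupervisedStep (f : X → Out T) (A : PDMatrix T) : Prop :=
  (f, A) ∈ P.feasible ∧ ∀ B, (f, B) ∈ P.feasible → P.objective (f, A) ≤ P.objective (f, B)

/-- `s i = (f_i, A_i)` is generated by alternating minimization: `f_0 = 0`, `A_0 = I_T`,
`f_{i+1}` minimizes `S(·, A_i)` and `A_{i+1}` minimizes `S(f_{i+1}, ·)`. -/
structure IsAlternatingMinimization (s : ℕ → (X → Out T) × PDMatrix T) : Prop where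
  init : s 0 = (0, PDMatrix.id T)
  supervised : ∀ i, P.IsSupervisedStep (s i).2 (s (i + 1)).1
  unsupervised : ∀ i, P.IsUnsupervisedStep (s (i + 1)).1 (s (i + 1)).2

/-- `s` is a minimizing sequence: it is feasible and its objective values tend to the infimum of
the objective over the feasible set. -/
def IsMinimizingSequence (s : ℕ → (X → Out T) × PDMatrix T) : Prop :=
  (∀ i, s i ∈ P.feasible) ∧
    ∃ m, IsGLB (P.objective '' P.feasible) m ∧ Tendsto (fun i => P.objective (s i)) atTop (𝓝 m)

end Problem

end SparseKernelMTL

end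

noncomputable section

namespace SparseKernelMTL

open scoped InnerProductSpace Matrix

/-! All spaces with kernel `k A` consist of the same functions `featureFun k w`, where `w` is a
`T`-tuple in the scalar feature space, and the squared norm is `⟨w, A⁻¹ w⟩`
(`exists_hyp_eq_featureFun`, `exists_featureFun_eq_hyp`). The feasible set thus becomes a product,
and the objective becomes `PenalizedRisk.value` on pairs `(w, A)`.

This value is jointly convex because `⟨w, A⁻¹ w⟩` is the supremum over `p` of `2⟨w, p⟩ - ⟨A p, p⟩`,
which is affine in `(w, A)`. The quantitative form `value_midpoint_le` shows that the midpoint gap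
controls the distances between the `A⁻¹ w` and between the `A⁻¹`. Along a minimizing sequence both
are therefore Cauchy, while the bound on `tr A` keeps the limit of the `A⁻¹` positive definite. This
gives well-posedness over every closed convex constraint set containing a pair with positive
definite matrix (`exists_minimizer`); it serves the full problem and both alternating steps.

For the alternation, the optimality conditions of the two steps would together certify global
optimality if they held at one common point. They hold at `w'` and `w` with the same `A`, and
`value_le_add_of_steps` bounds the loss by a multiple of `‖A⁻¹ (w' - w)‖`. The decrease of the
values forces this norm to zero, so the values tend to the minimum and well-posedness yields
convergence of the iterates. -/

theorem posDef_midpoint {ι : Type*} {A B : Matrix ι ι ℝ} (hA : A.PosDef) (hB : B.PosDef) :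
    ((1 / 2 : ℝ) • A + (1 / 2 : ℝ) • B).PosDef :=
  (hA.smul (by norm_num)).add (hB.smul (by norm_num))

/-! ### Matrices acting on Hilbert sums, and the form `⟨w, A⁻¹ w⟩`. -/

section Action

variable {ι E : Type*} [Fintype ι] [NormedAddCommGroup E] [InnerProductSpace ℝ E]

/-- The action `(M w)_t = ∑ₛ M_{ts} w_s` of real matrices on the Hilbert sum of copies of `E`. -/
def act : Matrix ι ι ℝ →ₗ[ℝ] PiLp 2 (fun _ : ι => E) →ₗ[ℝ] PiLp 2 (fun _ : ι => E) :=
  LinearMap.mk₂ ℝ (fun M w => WithLp.toLp 2 fun t => ∑ s, M t s • w s)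
    (fun M N w => by ext t; simp [add_smul, Finset.sum_add_distrib])
    (fun c M w => by ext t; simp [mul_smul, Finset.smul_sum])
    (fun M w v => by ext t; simp [smul_add, Finset.sum_add_distrib])
    (fun c M w => by ext t; simp [Finset.smul_sum, smul_comm c])

@[simp]
theorem act_apply (M : Matrix ι ι ℝ) (w : PiLp 2 (fun _ : ι => E)) (t : ι) :
    act M w t = ∑ s, M t s • w s := rfl

theorem act_mul (M N : Matrix ι ι ℝ) (w : PiLp 2 (fun _ : ι => E)) :
    act (M * N) w = act M (act N w) := by
  ext t
  simp only [act_apply, Matrix.mul_apply, Finset.sum_smul, Finset.smul_sum, mul_smul]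
  exact Finset.sum_comm

@[simp]
theorem act_one [DecidableEq ι] (w : PiLp 2 (fun _ : ι => E)) : act 1 w = w := by
  ext t
  simp [Matrix.one_apply]

theorem inner_act (M : Matrix ι ι ℝ) (u v : PiLp 2 (fun _ : ι => E)) :
    ⟪act M u, v⟫_ℝ = ⟪u, act Mᵀ v⟫_ℝ := by
  simp only [PiLp.inner_apply, act_apply, sum_inner, inner_sum, real_inner_smul_left,
    real_inner_smul_right, Matrix.transpose_apply]
  exact Finset.sum_comm

theorem inner_act_of_isHermitian {M : Matrix ι ι ℝ} (hM : M.IsHermitian)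
    (u v : PiLp 2 (fun _ : ι => E)) : ⟪act M u, v⟫_ℝ = ⟪u, act M v⟫_ℝ := by
  rw [inner_act, ← Matrix.conjTranspose_eq_transpose_of_trivial, hM.eq]

/-- Cauchy–Schwarz row by row: the operator norm is at most the Frobenius norm. -/
theorem norm_act_sq_le (M : Matrix ι ι ℝ) (u : PiLp 2 (fun _ : ι => E)) :
    ‖act M u‖ ^ 2 ≤ (M * Mᵀ).trace * ‖u‖ ^ 2 := by
  simp only [PiLp.norm_sq_eq_of_L2, Matrix.trace, Matrix.diag, Matrix.mul_apply,
    Matrix.transpose_apply, act_apply]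
  rw [Finset.sum_mul]
  refine Finset.sum_le_sum fun t _ => ?_
  have h1 : ‖∑ s, M t s • u s‖ ≤ ∑ s, |M t s| * ‖u s‖ :=
    (norm_sum_le _ _).trans_eq (by simp [norm_smul])
  calc ‖∑ s, M t s • u s‖ ^ 2 ≤ (∑ s, |M t s| * ‖u s‖) ^ 2 := by gcongr
    _ ≤ (∑ s, |M t s| ^ 2) * ∑ s, ‖u s‖ ^ 2 := Finset.sum_mul_sq_le_sq_mul_sq _ _ _
    _ = _ := by simp [sq]

theorem exists_transpose_mul_self_eq [DecidableEq ι] {A : Matrix ι ι ℝ} (hA : A.PosSemidef) :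
    ∃ C : Matrix ι ι ℝ, A = Cᵀ * C := by
  open scoped MatrixOrder in
  obtain ⟨C, hC⟩ := CStarAlgebra.nonneg_iff_eq_star_mul_self.mp hA.nonneg
  exact ⟨C, by rwa [Matrix.star_eq_conjTranspose,
    Matrix.conjTranspose_eq_transpose_of_trivial] at hC⟩

theorem inner_act_transpose_mul_self (C : Matrix ι ι ℝ) (u : PiLp 2 (fun _ : ι => E)) :
    ⟪act (Cᵀ * C) u, u⟫_ℝ = ‖act C u‖ ^ 2 := by
  rw [act_mul, inner_act, Matrix.transpose_transpose, real_inner_self_eq_norm_sq]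

theorem tendsto_act {α : Type*} {l : Filter α} {M : α → Matrix ι ι ℝ}
    {w : α → PiLp 2 (fun _ : ι => E)} {M₀ : Matrix ι ι ℝ} {w₀ : PiLp 2 (fun _ : ι => E)}
    (hM : Tendsto M l (𝓝 M₀)) (hw : Tendsto w l (𝓝 w₀)) :
    Tendsto (fun a => act (M a) (w a)) l (𝓝 (act M₀ w₀)) := by
  refine ((PiLp.continuous_toLp 2 (fun _ : ι => E)).tendsto _).comp
    (tendsto_pi_nhds.mpr fun t => tendsto_finsetSum _ fun s _ => Tendsto.smul ?_ ?_)
  · exact ((continuous_apply_apply t s).tendsto M₀).comp hM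
  · exact ((PiLp.continuous_apply 2 _ s).tendsto w₀).comp hw

variable [DecidableEq ι]

theorem inner_act_nonneg {A : Matrix ι ι ℝ} (hA : A.PosSemidef) (u : PiLp 2 (fun _ : ι => E)) :
    0 ≤ ⟪act A u, u⟫_ℝ := by
  obtain ⟨C, rfl⟩ := exists_transpose_mul_self_eq hA
  rw [inner_act_transpose_mul_self]
  positivity

theorem norm_act_le_trace {A : Matrix ι ι ℝ} (hA : A.PosSemidef)
    (u : PiLp 2 (fun _ : ι => E)) : ‖act A u‖ ≤ A.trace * ‖u‖ := by
  have h0 := hA.trace_nonneg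
  refine le_of_sq_le_sq ?_ (by positivity)
  obtain ⟨C, rfl⟩ := exists_transpose_mul_self_eq hA
  rw [act_mul, mul_pow]
  have h1 := norm_act_sq_le C u
  have h2 := norm_act_sq_le Cᵀ (act C u)
  rw [Matrix.transpose_transpose] at h2
  rw [Matrix.trace_mul_comm] at h1
  nlinarith [mul_le_mul_of_nonneg_left h1 h0]

/-- With `A = Cᵀ C` and `u = C⁻¹ (C u)`, the squared Frobenius norm of `C⁻¹` is `tr A⁻¹`. The
coercivity of `A` is thus measured by a quantity that the objective bounds. -/
theorem norm_sq_le_trace_inv_mul {A : Matrix ι ι ℝ} (hA : A.PosDef)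
    (u : PiLp 2 (fun _ : ι => E)) : ‖u‖ ^ 2 ≤ A⁻¹.trace * ⟪act A u, u⟫_ℝ := by
  obtain ⟨C, rfl⟩ := exists_transpose_mul_self_eq hA.posSemidef
  have hu := hA.isUnit
  have hdet : IsUnit C.det := by
    rw [Matrix.isUnit_iff_isUnit_det, Matrix.det_mul] at hu
    exact isUnit_of_mul_isUnit_right hu
  rw [inner_act_transpose_mul_self, Matrix.mul_inv_rev, ← Matrix.transpose_nonsing_inv]
  have h := norm_act_sq_le C⁻¹ (act C u)
  rwa [← act_mul, Matrix.nonsing_inv_mul _ hdet, act_one] at h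

theorem mul_inv_cancel_of_posDef {A : Matrix ι ι ℝ} (hA : A.PosDef) : A * A⁻¹ = 1 :=
  Matrix.mul_nonsing_inv _ ((Matrix.isUnit_iff_isUnit_det _).mp hA.isUnit)

theorem act_act_inv {A : Matrix ι ι ℝ} (hA : A.PosDef) (u : PiLp 2 (fun _ : ι => E)) :
    act A (act A⁻¹ u) = u := by
  rw [← act_mul, mul_inv_cancel_of_posDef hA, act_one]

/-- The quadratic form `⟨w, A⁻¹ w⟩`. -/
def invForm (w : PiLp 2 (fun _ : ι => E)) (A : Matrix ι ι ℝ) : ℝ := ⟪w, act A⁻¹ w⟫_ℝ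

theorem invForm_nonneg {A : Matrix ι ι ℝ} (hA : A.PosDef) (w : PiLp 2 (fun _ : ι => E)) :
    0 ≤ invForm w A := by
  rw [invForm, real_inner_comm]
  exact inner_act_nonneg hA.inv.posSemidef w

theorem inner_act_act_inv_self {A : Matrix ι ι ℝ} (hA : A.PosDef)
    (w : PiLp 2 (fun _ : ι => E)) : ⟪act A (act A⁻¹ w), act A⁻¹ w⟫_ℝ = invForm w A := by
  rw [act_act_inv hA, invForm]

theorem norm_act_inv_sq_le {A : Matrix ι ι ℝ} (hA : A.PosDef)
    (w : PiLp 2 (fun _ : ι => E)) : ‖act A⁻¹ w‖ ^ 2 ≤ A⁻¹.trace * invForm w A := by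
  rw [← inner_act_act_inv_self hA]
  exact norm_sq_le_trace_inv_mul hA _

/-- Completing the square around the maximizer `p = A⁻¹ w` of the variational formula; the remainder
is what makes the convexity quantitative. -/
theorem invForm_eq {A : Matrix ι ι ℝ} (hA : A.PosDef) (w p : PiLp 2 (fun _ : ι => E)) :
    invForm w A = 2 * ⟪w, p⟫_ℝ - ⟪act A p, p⟫_ℝ
      + ⟪act A (act A⁻¹ w - p), act A⁻¹ w - p⟫_ℝ := by
  rw [map_sub, act_act_inv hA, inner_sub_left, inner_sub_right, inner_sub_right,
    inner_act_of_isHermitian hA.isHermitian p (act A⁻¹ w), act_act_inv hA, real_inner_comm w p,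
    invForm]
  ring

theorem le_invForm {A : Matrix ι ι ℝ} (hA : A.PosDef) (w p : PiLp 2 (fun _ : ι => E)) :
    2 * ⟪w, p⟫_ℝ - ⟪act A p, p⟫_ℝ ≤ invForm w A := by
  rw [invForm_eq hA w p]
  linarith [inner_act_nonneg hA.posSemidef (act A⁻¹ w - p)]

theorem invForm_add_smul {A : Matrix ι ι ℝ} (hA : A.PosDef) (w d : PiLp 2 (fun _ : ι => E))
    (t : ℝ) :
    invForm (w + t • d) A = invForm w A + 2 * t * ⟪d, act A⁻¹ w⟫_ℝ + t ^ 2 * invForm d A := by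
  have h : ⟪w, act A⁻¹ d⟫_ℝ = ⟪d, act A⁻¹ w⟫_ℝ := by
    rw [← inner_act_of_isHermitian hA.inv.isHermitian, real_inner_comm]
  simp only [invForm, map_add, map_smul, inner_add_left, inner_add_right, real_inner_smul_left,
    real_inner_smul_right, h]
  ring

/-- Evaluate `invForm_eq` at both endpoints with the optimal `p` of the midpoint. The affine parts
average exactly, and each square remainder is at least `1 / c` times a squared norm. -/
theorem invForm_midpoint_le {A B : Matrix ι ι ℝ} (hA : A.PosDef) (hB : B.PosDef) {c : ℝ}
    (hc : 0 < c) (hAc : A⁻¹.trace ≤ c) (hBc : B⁻¹.trace ≤ c)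
    (u v : PiLp 2 (fun _ : ι => E)) :
    invForm ((1 / 2 : ℝ) • u + (1 / 2 : ℝ) • v) ((1 / 2 : ℝ) • A + (1 / 2 : ℝ) • B)
      + ‖act A⁻¹ u - act B⁻¹ v‖ ^ 2 / (4 * c) ≤ (invForm u A + invForm v B) / 2 := by
  have hM := posDef_midpoint hA hB
  set M := (1 / 2 : ℝ) • A + (1 / 2 : ℝ) • B with hMdef
  set m := (1 / 2 : ℝ) • u + (1 / 2 : ℝ) • v with hmdef
  set p := act M⁻¹ m with hp
  have h0 : invForm m M = 2 * ⟪m, p⟫_ℝ - ⟪act M p, p⟫_ℝ := by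
    rw [invForm_eq hM m p]; simp [hp]
  have h1 : ⟪m, p⟫_ℝ = (⟪u, p⟫_ℝ + ⟪v, p⟫_ℝ) / 2 := by
    simp only [hmdef, inner_add_left, real_inner_smul_left]; ring
  have h2 : ⟪act M p, p⟫_ℝ = (⟪act A p, p⟫_ℝ + ⟪act B p, p⟫_ℝ) / 2 := by
    simp only [hMdef, map_add, map_smul, LinearMap.add_apply, LinearMap.smul_apply,
      inner_add_left, real_inner_smul_left]; ring
  have key : ∀ {D : Matrix ι ι ℝ}, D.PosDef → D⁻¹.trace ≤ c → ∀ x : PiLp 2 (fun _ : ι => E),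
      ‖x‖ ^ 2 / c ≤ ⟪act D x, x⟫_ℝ := by
    intro D hD hDc x
    rw [div_le_iff₀ hc, mul_comm]
    exact (norm_sq_le_trace_inv_mul hD x).trans
      (mul_le_mul_of_nonneg_right hDc (inner_act_nonneg hD.posSemidef x))
  have h3 := key hA hAc (act A⁻¹ u - p)
  have h4 := key hB hBc (act B⁻¹ v - p)
  -- Eliminates `p`; the factor 2 here and the averaging produce `4 * c`.
  have h5 : ‖act A⁻¹ u - act B⁻¹ v‖ ^ 2 ≤
      2 * (‖act A⁻¹ u - p‖ ^ 2 + ‖act B⁻¹ v - p‖ ^ 2) := by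
    have := parallelogram_law_with_norm ℝ (act A⁻¹ u - p) (act B⁻¹ v - p)
    rw [sub_sub_sub_cancel_right] at this
    nlinarith [norm_nonneg (act A⁻¹ u - p + (act B⁻¹ v - p))]
  have h6 : ‖act A⁻¹ u - act B⁻¹ v‖ ^ 2 / (4 * c) ≤
      (‖act A⁻¹ u - p‖ ^ 2 / c + ‖act B⁻¹ v - p‖ ^ 2 / c) / 2 := by
    rw [← add_div, div_div, div_le_div_iff₀ (by positivity) (by positivity)]
    nlinarith
  rw [invForm_eq hA u p, invForm_eq hB v p, h0, h1, h2]
  linarith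

variable (ι) in
/-- The identity matrix as a family of vectors. -/
def idFamily : PiLp 2 (fun _ : ι => EuclideanSpace ℝ ι) :=
  WithLp.toLp 2 fun t => EuclideanSpace.single t 1

theorem act_idFamily (M : Matrix ι ι ℝ) (t s : ι) : act M (idFamily ι) t s = M t s := by
  simp [idFamily, Pi.single_apply]

/-- Makes the barrier `tr A⁻¹` an instance of `invForm`, so that its convexity, continuity and
midpoint gap need no separate proof. -/
theorem invForm_idFamily (A : Matrix ι ι ℝ) : invForm (idFamily ι) A = A⁻¹.trace := by
  simp only [invForm, PiLp.inner_apply, Matrix.trace, Matrix.diag, ← act_idFamily]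
  simp [idFamily, Pi.single_apply]

theorem abs_apply_le_norm_act_idFamily (M : Matrix ι ι ℝ) (t s : ι) :
    |M t s| ≤ ‖act M (idFamily ι)‖ := by
  rw [← act_idFamily M t s, ← Real.norm_eq_abs]
  exact (PiLp.norm_apply_le _ s).trans (PiLp.norm_apply_le _ t)

theorem continuousAt_inv_of_posDef {A : Matrix ι ι ℝ} (hA : A.PosDef) :
    ContinuousAt (fun B : Matrix ι ι ℝ => B⁻¹) A := by
  refine continuousAt_matrix_inv A ?_
  have h : A.det ≠ 0 := ((Matrix.isUnit_iff_isUnit_det _).mp hA.isUnit).ne_zero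
  simpa [funext Ring.inverse_eq_inv] using continuousAt_inv₀ h

theorem tendsto_invForm {α : Type*} {l : Filter α} {A : α → Matrix ι ι ℝ}
    {w : α → PiLp 2 (fun _ : ι => E)} {A₀ : Matrix ι ι ℝ} {w₀ : PiLp 2 (fun _ : ι => E)}
    (hA₀ : A₀.PosDef) (hA : Tendsto A l (𝓝 A₀)) (hw : Tendsto w l (𝓝 w₀)) :
    Tendsto (fun a => invForm (w a) (A a)) l (𝓝 (invForm w₀ A₀)) :=
  hw.inner (tendsto_act ((continuousAt_inv_of_posDef hA₀).tendsto.comp hA) hw)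

end Action

/-! ### Well-posedness of the penalized problem. -/

section Minimization

theorem cauchySeq_of_norm_sub_sq_le {G : Type*} [SeminormedAddCommGroup G] {x : ℕ → G}
    {a : ℕ → ℝ} (ha : Tendsto a atTop (𝓝 0)) (h : ∀ i j, ‖x i - x j‖ ^ 2 ≤ a i + a j) :
    CauchySeq x := by
  rw [Metric.cauchySeq_iff]
  intro r hr
  have hr2 : 0 < r ^ 2 / 2 := by positivity
  obtain ⟨N, hN⟩ := eventually_atTop.mp (ha.eventually (gt_mem_nhds hr2))
  refine ⟨N, fun i hi j hj => ?_⟩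
  rw [dist_eq_norm]
  refine lt_of_pow_lt_pow_left₀ 2 hr.le ?_
  linarith [h i j, hN i hi, hN j hj]

variable {ι E : Type*} [Fintype ι] [NormedAddCommGroup E] [InnerProductSpace ℝ E]

variable (ι E) in
/-- The data of a functional `h(w) + λ (⟨w, A⁻¹ w⟩ + ε tr(A⁻¹) + μ tr(A) + (1 - μ) ‖A‖_{ℓ₁})` with
a convex continuous nonnegative `h`. -/
structure PenalizedRisk where
  /-- the empirical risk -/
  risk : PiLp 2 (fun _ : ι => E) → ℝ
  risk_nonneg : ∀ w, 0 ≤ risk w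
  convexOn_risk : ConvexOn ℝ Set.univ risk
  continuous_risk : Continuous risk
  /-- the weight `λ` of the penalty -/
  lam : ℝ
  lam_pos : 0 < lam
  /-- the weight `ε` of the barrier -/
  eps : ℝ
  eps_pos : 0 < eps
  /-- the balance `μ` between trace and `ℓ₁` norm -/
  mu : ℝ
  mu_mem : mu ∈ Set.Icc (0 : ℝ) 1

namespace PenalizedRisk

variable (F : PenalizedRisk ι E)

/-- The sparsity penalty `μ tr(A) + (1 - μ) ‖A‖_{ℓ₁}`. -/
def sparsity (A : Matrix ι ι ℝ) : ℝ := F.mu * A.trace + (1 - F.mu) * ∑ t, ∑ s, |A t s|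

theorem sparsity_add_le {a b : ℝ} (ha : 0 ≤ a) (hb : 0 ≤ b) (A B : Matrix ι ι ℝ) :
    F.sparsity (a • A + b • B) ≤ a * F.sparsity A + b * F.sparsity B := by
  have h : ∑ t, ∑ s, |(a • A + b • B) t s| ≤
      a * ∑ t, ∑ s, |A t s| + b * ∑ t, ∑ s, |B t s| := by
    simp only [Finset.mul_sum, ← Finset.sum_add_distrib]
    refine Finset.sum_le_sum fun t _ => Finset.sum_le_sum fun s _ => ?_
    refine (abs_add_le _ _).trans_eq ?_
    simp [abs_mul, abs_of_nonneg ha, abs_of_nonneg hb]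
  have := mul_le_mul_of_nonneg_left h (sub_nonneg.mpr F.mu_mem.2)
  simp only [sparsity, Matrix.trace_add, Matrix.trace_smul, smul_eq_mul]
  linarith

/-- The trace is at most the `ℓ₁` norm, so the penalty bounds `tr A` uniformly in `μ`, including `μ
= 0`. -/
theorem trace_le_sparsity (A : Matrix ι ι ℝ) : A.trace ≤ F.sparsity A := by
  have h : A.trace ≤ ∑ t, ∑ s, |A t s| :=
    Finset.sum_le_sum fun t _ => (le_abs_self _).trans
      (Finset.single_le_sum (f := fun s => |A t s|) (fun s _ => abs_nonneg _)
        (Finset.mem_univ t))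
  have := mul_le_mul_of_nonneg_left h (sub_nonneg.mpr F.mu_mem.2)
  rw [sparsity]
  linarith

theorem continuous_sparsity : Continuous F.sparsity := by
  unfold sparsity Matrix.trace Matrix.diag
  fun_prop

variable [DecidableEq ι]

/-- The part of the penalty that only involves the matrix. -/
def matPenalty (A : Matrix ι ι ℝ) : ℝ := F.eps * A⁻¹.trace + F.sparsity A

/-- The value of the functional. -/
def value (z : PiLp 2 (fun _ : ι => E) × Matrix ι ι ℝ) : ℝ :=
  F.risk z.1 + F.lam * (invForm z.1 z.2 + F.matPenalty z.2)

theorem trace_inv_le {z : PiLp 2 (fun _ : ι => E) × Matrix ι ι ℝ} (hz : z.2.PosDef) :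
    z.2⁻¹.trace ≤ F.value z / (F.lam * F.eps) := by
  rw [le_div_iff₀ (mul_pos F.lam_pos F.eps_pos), value, matPenalty]
  have h1 := F.risk_nonneg z.1
  have h2 := mul_nonneg F.lam_pos.le (invForm_nonneg hz z.1)
  have h3 := mul_nonneg F.lam_pos.le
    (hz.posSemidef.trace_nonneg.trans (F.trace_le_sparsity z.2))
  linarith

theorem trace_le {z : PiLp 2 (fun _ : ι => E) × Matrix ι ι ℝ} (hz : z.2.PosDef) :
    z.2.trace ≤ F.value z / F.lam := by
  rw [le_div_iff₀ F.lam_pos, value, matPenalty]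
  have h1 := F.risk_nonneg z.1
  have h2 := mul_nonneg F.lam_pos.le (invForm_nonneg hz z.1)
  have h3 := mul_le_mul_of_nonneg_left (F.trace_le_sparsity z.2) F.lam_pos.le
  have h4 := mul_nonneg F.lam_pos.le
    (mul_nonneg F.eps_pos.le hz.inv.posSemidef.trace_nonneg)
  linarith

theorem invForm_le {z : PiLp 2 (fun _ : ι => E) × Matrix ι ι ℝ} (hz : z.2.PosDef) :
    invForm z.1 z.2 ≤ F.value z / F.lam := by
  rw [le_div_iff₀ F.lam_pos, value, matPenalty]
  have h1 := F.risk_nonneg z.1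
  have h3 := mul_nonneg F.lam_pos.le
    (hz.posSemidef.trace_nonneg.trans (F.trace_le_sparsity z.2))
  have h4 := mul_nonneg F.lam_pos.le
    (mul_nonneg F.eps_pos.le hz.inv.posSemidef.trace_nonneg)
  linarith

theorem value_nonneg {z : PiLp 2 (fun _ : ι => E) × Matrix ι ι ℝ} (hz : z.2.PosDef) :
    0 ≤ F.value z := by
  have h := (invForm_nonneg hz z.1).trans (F.invForm_le hz)
  rw [le_div_iff₀ F.lam_pos, zero_mul] at h
  exact h

theorem tendsto_value {α : Type*} {l : Filter α}
    {z : α → PiLp 2 (fun _ : ι => E) × Matrix ι ι ℝ}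
    {z₀ : PiLp 2 (fun _ : ι => E) × Matrix ι ι ℝ} (hz₀ : z₀.2.PosDef)
    (hz : Tendsto z l (𝓝 z₀)) : Tendsto (fun a => F.value (z a)) l (𝓝 (F.value z₀)) := by
  have h1 : Tendsto (fun a => (z a).1) l (𝓝 z₀.1) := (continuous_fst.tendsto z₀).comp hz
  have h2 : Tendsto (fun a => (z a).2) l (𝓝 z₀.2) := (continuous_snd.tendsto z₀).comp hz
  have h3 : Tendsto (fun a => (z a).2⁻¹.trace) l (𝓝 z₀.2⁻¹.trace) := by
    simp only [← invForm_idFamily]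
    exact tendsto_invForm hz₀ h2 tendsto_const_nhds
  exact ((F.continuous_risk.tendsto _).comp h1).add
    (((tendsto_invForm hz₀ h2 h1).add ((h3.const_mul _).add
      ((F.continuous_sparsity.tendsto _).comp h2))).const_mul _)

/-- `invForm_midpoint_le` is used twice: for the coefficients, and for the identity family, where it
turns the barrier into control of `A⁻¹`. -/
theorem value_midpoint_le {z z' : PiLp 2 (fun _ : ι => E) × Matrix ι ι ℝ} (hz : z.2.PosDef)
    (hz' : z'.2.PosDef) {c : ℝ} (hc : 0 < c) (hzc : z.2⁻¹.trace ≤ c) (hzc' : z'.2⁻¹.trace ≤ c) :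
    F.value ((1 / 2 : ℝ) • z + (1 / 2 : ℝ) • z')
      + F.lam / (4 * c) * (‖act z.2⁻¹ z.1 - act z'.2⁻¹ z'.1‖ ^ 2
        + F.eps * ‖act (z.2⁻¹ - z'.2⁻¹) (idFamily ι)‖ ^ 2) ≤ (F.value z + F.value z') / 2 := by
  have h1 := F.convexOn_risk.2 (Set.mem_univ z.1) (Set.mem_univ z'.1)
    (by norm_num : (0 : ℝ) ≤ 1 / 2) (by norm_num : (0 : ℝ) ≤ 1 / 2) (by norm_num)
  have h2 := invForm_midpoint_le hz hz' hc hzc hzc' z.1 z'.1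
  have h3 := invForm_midpoint_le hz hz' hc hzc hzc' (idFamily ι) (idFamily ι)
  rw [← add_smul, show (1 / 2 + 1 / 2 : ℝ) = 1 by norm_num, one_smul, invForm_idFamily,
    invForm_idFamily, invForm_idFamily, ← LinearMap.sub_apply, ← map_sub] at h3
  have h4 := F.sparsity_add_le (by norm_num : (0 : ℝ) ≤ 1 / 2) (by norm_num : (0 : ℝ) ≤ 1 / 2)
    z.2 z'.2
  have h5 := mul_le_mul_of_nonneg_left
    (add_le_add h2 (add_le_add (mul_le_mul_of_nonneg_left h3 F.eps_pos.le) h4)) F.lam_pos.le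
  simp only [value, matPenalty, Prod.fst_add, Prod.snd_add, Prod.smul_fst, Prod.smul_snd,
    smul_eq_mul] at h1 h5 ⊢
  calc _ = F.risk ((1 / 2 : ℝ) • z.1 + (1 / 2 : ℝ) • z'.1) + F.lam * _ := by
        rw [add_assoc]; congr 1; rw [div_mul_eq_mul_div, mul_div_assoc, ← mul_add]
    _ ≤ _ := add_le_add h1 (le_trans (le_of_eq ?_) h5)
    _ = _ := by ring
  ring

/-- The midpoint stays in `Z`, so its value is at least `m` and the gap is at most the mean excess
of the two values. The sequence is recovered from the limits of `A⁻¹` and `A⁻¹ w`. -/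
theorem exists_tendsto_of_minimizing [CompleteSpace E]
    {Z : Set (PiLp 2 (fun _ : ι => E) × Matrix ι ι ℝ)} (hZ : Convex ℝ Z) (hZc : IsClosed Z) {m : ℝ}
    (hm : ∀ z ∈ Z, z.2.PosDef → m ≤ F.value z)
    {z : ℕ → PiLp 2 (fun _ : ι => E) × Matrix ι ι ℝ} (hz : ∀ i, z i ∈ Z)
    (hpd : ∀ i, (z i).2.PosDef) (hlim : Tendsto (fun i => F.value (z i)) atTop (𝓝 m)) :
    ∃ z₀ ∈ Z, z₀.2.PosDef ∧ Tendsto z atTop (𝓝 z₀) ∧ F.value z₀ = m := by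
  obtain ⟨b, hb⟩ := hlim.bddAbove_range
  have hb' : ∀ i, F.value (z i) ≤ b := fun i => hb ⟨i, rfl⟩
  have hb0 : 0 ≤ b := (F.value_nonneg (hpd 0)).trans (hb' 0)
  have hlam := F.lam_pos
  have heps := F.eps_pos
  -- The added 1 keeps the constant positive even when `b = 0`; likewise for `d`.
  set c := b / (F.lam * F.eps) + 1 with hcdef
  have hc : 0 < c := by positivity
  have hic : ∀ i, (z i).2⁻¹.trace ≤ c := fun i =>
    (F.trace_inv_le (hpd i)).trans
      ((div_le_div_of_nonneg_right (hb' i) (by positivity)).trans (by linarith))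
  set d := b / F.lam + 1 with hddef
  have hd : 0 < d := by positivity
  have htr : ∀ i, (z i).2.trace ≤ d := fun i =>
    (F.trace_le (hpd i)).trans
      ((div_le_div_of_nonneg_right (hb' i) hlam.le).trans (by linarith))
  have gap : ∀ i j, F.lam / (4 * c) * (‖act (z i).2⁻¹ (z i).1 - act (z j).2⁻¹ (z j).1‖ ^ 2
        + F.eps * ‖act ((z i).2⁻¹ - (z j).2⁻¹) (idFamily ι)‖ ^ 2)
      ≤ (F.value (z i) - m) / 2 + (F.value (z j) - m) / 2 := by
    intro i j
    have h1 := F.value_midpoint_le (hpd i) (hpd j) hc (hic i) (hic j)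
    have h2 := hm _ (hZ (hz i) (hz j) (by norm_num : (0 : ℝ) ≤ 1 / 2)
      (by norm_num : (0 : ℝ) ≤ 1 / 2) (by norm_num)) (posDef_midpoint (hpd i) (hpd j))
    linarith
  have h0 : Tendsto (fun i => F.value (z i) - m) atTop (𝓝 0) := by
    simpa using hlim.sub_const m
  have hcauchy1 : CauchySeq fun i => act (z i).2⁻¹ (z i).1 := by
    refine cauchySeq_of_norm_sub_sq_le
      (a := fun i => (F.lam / (4 * c))⁻¹ * ((F.value (z i) - m) / 2)) ?_ fun i j => ?_
    · simpa using (h0.div_const 2).const_mul (F.lam / (4 * c))⁻¹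
    · rw [← mul_add, inv_mul_eq_div, le_div_iff₀' (by positivity)]
      refine le_trans ?_ (gap i j)
      gcongr
      exact le_add_of_nonneg_right (by positivity)
  have hcauchy2 : ∀ t s, CauchySeq fun i => (z i).2⁻¹ t s := by
    intro t s
    refine cauchySeq_of_norm_sub_sq_le
      (a := fun i => (F.lam / (4 * c) * F.eps)⁻¹ * ((F.value (z i) - m) / 2)) ?_ fun i j => ?_
    · simpa using (h0.div_const 2).const_mul (F.lam / (4 * c) * F.eps)⁻¹
    · rw [← mul_add, inv_mul_eq_div, le_div_iff₀' (by positivity)]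
      refine le_trans ?_ (gap i j)
      rw [mul_assoc]
      gcongr
      refine le_trans ?_ (le_add_of_nonneg_left (by positivity))
      gcongr
      exact abs_apply_le_norm_act_idFamily ((z i).2⁻¹ - (z j).2⁻¹) t s
  obtain ⟨p, hp⟩ := cauchySeq_tendsto_of_complete hcauchy1
  choose P hP using fun t s => cauchySeq_tendsto_of_complete (hcauchy2 t s)
  have hPlim : Tendsto (fun i => (z i).2⁻¹) atTop (𝓝 (Matrix.of P)) :=
    tendsto_pi_nhds.mpr fun t => tendsto_pi_nhds.mpr fun s => hP t s
  have hPpd : (Matrix.of P).PosDef := by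
    refine Matrix.PosDef.of_dotProduct_mulVec_pos ?_ fun x hx => ?_
    · have h1 : Tendsto (fun i => ((z i).2⁻¹)ᴴ) atTop (𝓝 (Matrix.of P)ᴴ) :=
        (continuous_id.matrix_conjTranspose.tendsto (Matrix.of P)).comp hPlim
      refine tendsto_nhds_unique (h1.congr fun i => ?_) hPlim
      exact (hpd i).inv.isHermitian.eq
    · set u : PiLp 2 (fun _ : ι => ℝ) := WithLp.toLp 2 x with hu
      have h1 : Tendsto (fun i => ⟪act (z i).2⁻¹ u, u⟫_ℝ) atTop
          (𝓝 ⟪act (Matrix.of P) u, u⟫_ℝ) :=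
        (tendsto_act hPlim tendsto_const_nhds).inner tendsto_const_nhds
      -- Since `tr A ≤ d`, the inverses are bounded below by `1 / d`, and this survives the limit.
      have h2 : ∀ i, ‖u‖ ^ 2 / d ≤ ⟪act (z i).2⁻¹ u, u⟫_ℝ := by
        intro i
        rw [div_le_iff₀ hd]
        have h3 := norm_sq_le_trace_inv_mul (hpd i).inv u
        rw [Matrix.nonsing_inv_nonsing_inv _
          ((Matrix.isUnit_iff_isUnit_det _).mp (hpd i).isUnit)] at h3
        rw [mul_comm]
        exact h3.trans (mul_le_mul_of_nonneg_right (htr i)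
          (inner_act_nonneg (hpd i).inv.posSemidef u))
      have h4 : 0 < ‖u‖ ^ 2 / d := by
        have : u ≠ 0 := by simpa [hu] using hx
        positivity
      have h5 : star x ⬝ᵥ (Matrix.of P).mulVec x = ⟪act (Matrix.of P) u, u⟫_ℝ := by
        simp [PiLp.inner_apply, dotProduct, Matrix.mulVec, hu]
      rw [h5]
      exact h4.trans_le (ge_of_tendsto' h1 h2)
  have hAlim : Tendsto (fun i => (z i).2) atTop (𝓝 (Matrix.of P)⁻¹) := by
    refine ((continuousAt_inv_of_posDef hPpd).tendsto.comp hPlim).congr fun i => ?_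
    exact Matrix.nonsing_inv_nonsing_inv _ ((Matrix.isUnit_iff_isUnit_det _).mp (hpd i).isUnit)
  have hwlim : Tendsto (fun i => (z i).1) atTop (𝓝 (act (Matrix.of P)⁻¹ p)) :=
    (tendsto_act hAlim hp).congr fun i => act_act_inv (hpd i) _
  have hzlim : Tendsto z atTop (𝓝 (act (Matrix.of P)⁻¹ p, (Matrix.of P)⁻¹)) :=
    hwlim.prodMk_nhds hAlim
  exact ⟨_, hZc.mem_of_tendsto hzlim (Eventually.of_forall hz), hPpd.inv, hzlim,
    tendsto_nhds_unique (F.tendsto_value hPpd.inv hzlim) hlim⟩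

theorem eq_of_minimizers {Z : Set (PiLp 2 (fun _ : ι => E) × Matrix ι ι ℝ)} (hZ : Convex ℝ Z)
    {m : ℝ} (hm : ∀ z ∈ Z, z.2.PosDef → m ≤ F.value z)
    {z z' : PiLp 2 (fun _ : ι => E) × Matrix ι ι ℝ} (hz : z ∈ Z) (hz' : z' ∈ Z)
    (hpd : z.2.PosDef) (hpd' : z'.2.PosDef) (h : F.value z = m) (h' : F.value z' = m) :
    z = z' := by
  set c := max z.2⁻¹.trace z'.2⁻¹.trace + 1 with hcdef
  have hc : 0 < c := by
    have := hpd.inv.posSemidef.trace_nonneg.trans (le_max_left _ z'.2⁻¹.trace)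
    linarith
  have h1 := F.value_midpoint_le hpd hpd' hc
    (by linarith [le_max_left z.2⁻¹.trace z'.2⁻¹.trace])
    (by linarith [le_max_right z.2⁻¹.trace z'.2⁻¹.trace])
  have h2 := hm _ (hZ hz hz' (by norm_num : (0 : ℝ) ≤ 1 / 2)
    (by norm_num : (0 : ℝ) ≤ 1 / 2) (by norm_num)) (posDef_midpoint hpd hpd')
  have hlam := F.lam_pos
  have heps := F.eps_pos
  have h3 : F.lam / (4 * c) * (‖act z.2⁻¹ z.1 - act z'.2⁻¹ z'.1‖ ^ 2
        + F.eps * ‖act (z.2⁻¹ - z'.2⁻¹) (idFamily ι)‖ ^ 2) ≤ F.lam / (4 * c) * 0 := by linarith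
  have h4 := le_of_mul_le_mul_left h3 (by positivity)
  have h5 : ‖act z.2⁻¹ z.1 - act z'.2⁻¹ z'.1‖ ^ 2 = 0 := by
    refine le_antisymm (le_trans ?_ h4) (by positivity)
    exact le_add_of_nonneg_right (by positivity)
  have h6 : ‖act (z.2⁻¹ - z'.2⁻¹) (idFamily ι)‖ ^ 2 = 0 := by
    rw [h5, zero_add] at h4
    exact le_antisymm (nonpos_of_mul_nonpos_right h4 heps) (by positivity)
  have h7 : z.2⁻¹ = z'.2⁻¹ := by
    ext t s
    have := abs_apply_le_norm_act_idFamily (z.2⁻¹ - z'.2⁻¹) t s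
    rw [pow_eq_zero_iff two_ne_zero |>.mp h6] at this
    exact sub_eq_zero.mp (abs_nonpos_iff.mp this)
  have h8 : z.2 = z'.2 := by
    rw [← Matrix.nonsing_inv_nonsing_inv z.2 ((Matrix.isUnit_iff_isUnit_det _).mp hpd.isUnit), h7,
      Matrix.nonsing_inv_nonsing_inv _ ((Matrix.isUnit_iff_isUnit_det _).mp hpd'.isUnit)]
  refine Prod.ext ?_ h8
  have h9 : act z.2⁻¹ z.1 = act z'.2⁻¹ z'.1 := by
    rwa [pow_eq_zero_iff two_ne_zero, norm_sub_eq_zero_iff] at h5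
  rw [← act_act_inv hpd z.1, h9, h8, act_act_inv hpd']

/-- A constrained minimization problem over a closed convex set is well-posed: there is a minimizer
to which every minimizing sequence converges. -/
theorem exists_minimizer [CompleteSpace E]
    {Z : Set (PiLp 2 (fun _ : ι => E) × Matrix ι ι ℝ)} (hZ : Convex ℝ Z) (hZc : IsClosed Z)
    (hne : ∃ z ∈ Z, z.2.PosDef) :
    ∃ z₀ ∈ Z, z₀.2.PosDef ∧ (∀ z ∈ Z, z.2.PosDef → F.value z₀ ≤ F.value z) ∧
      ∀ z : ℕ → PiLp 2 (fun _ : ι => E) × Matrix ι ι ℝ, (∀ i, z i ∈ Z) → (∀ i, (z i).2.PosDef) →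
        Tendsto (fun i => F.value (z i)) atTop (𝓝 (F.value z₀)) → Tendsto z atTop (𝓝 z₀) := by
  set V := F.value '' {z | z ∈ Z ∧ z.2.PosDef} with hV
  have hVne : V.Nonempty := by
    obtain ⟨z, hz, hpd⟩ := hne
    exact ⟨_, z, ⟨hz, hpd⟩, rfl⟩
  have hVbdd : BddBelow V := ⟨0, by
    rintro _ ⟨z, ⟨-, hpd⟩, rfl⟩
    exact F.value_nonneg hpd⟩
  have hm : ∀ z ∈ Z, z.2.PosDef → sInf V ≤ F.value z :=
    fun z hz hpd => csInf_le hVbdd ⟨z, ⟨hz, hpd⟩, rfl⟩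
  obtain ⟨v, -, hvlim, hvmem⟩ := exists_seq_tendsto_sInf hVne hVbdd
  choose z hz hzv using hvmem
  obtain ⟨z₀, hz₀, hpd₀, -, hval⟩ := F.exists_tendsto_of_minimizing hZ hZc hm
    (fun i => (hz i).1) (fun i => (hz i).2) (by simpa only [hzv] using hvlim)
  -- Any minimizing sequence converges to some minimizer, which uniqueness identifies with `z₀`.
  refine ⟨z₀, hz₀, hpd₀, fun z hz hpd => hval ▸ hm z hz hpd, fun y hy hypd hylim => ?_⟩
  obtain ⟨y₀, hy₀, hypd₀, hlim, hyval⟩ :=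
    F.exists_tendsto_of_minimizing hZ hZc hm hy hypd (hval ▸ hylim)
  rwa [F.eq_of_minimizers hZ hm hz₀ hy₀ hpd₀ hypd₀ hval hyval]

end PenalizedRisk

end Minimization

/-! ### Optimality conditions of the two steps and decay of the values. -/

section Alternation

theorem nonneg_of_tendsto_of_small {φ : ℝ → ℝ} {a : ℝ}
    (h : ∀ t, 0 < t → t < 1 → 0 ≤ φ t) (hφ : Tendsto φ (𝓝[>] 0) (𝓝 a)) : 0 ≤ a :=
  ge_of_tendsto hφ (by
    filter_upwards [Ioo_mem_nhdsGT (zero_lt_one' ℝ)] with t ht using h t ht.1 ht.2)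

variable {ι E : Type*} [Fintype ι] [DecidableEq ι] [NormedAddCommGroup E] [InnerProductSpace ℝ E]

theorem invForm_convex {A B : Matrix ι ι ℝ} (hA : A.PosDef) (hB : B.PosDef) {a b : ℝ}
    (ha : 0 < a) (hb : 0 < b) (hab : a + b = 1) (w : PiLp 2 (fun _ : ι => E)) :
    invForm w (a • A + b • B) ≤ a * invForm w A + b * invForm w B := by
  have hM : (a • A + b • B).PosDef := (hA.smul ha).add (hB.smul hb)
  set p := act (a • A + b • B)⁻¹ w with hp
  have h0 : invForm w (a • A + b • B) = 2 * ⟪w, p⟫_ℝ - ⟪act (a • A + b • B) p, p⟫_ℝ := by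
    rw [invForm_eq hM w p]; simp [hp]
  have h1 := mul_le_mul_of_nonneg_left (le_invForm hA w p) ha.le
  have h2 := mul_le_mul_of_nonneg_left (le_invForm hB w p) hb.le
  simp only [map_add, map_smul, LinearMap.add_apply, LinearMap.smul_apply,
    inner_add_left, real_inner_smul_left] at h0
  rw [h0]
  have h3 : 2 * ⟪w, p⟫_ℝ = a * (2 * ⟪w, p⟫_ℝ) + b * (2 * ⟪w, p⟫_ℝ) := by
    rw [← add_mul, hab, one_mul]
  linarith

theorem inner_act_sub_inner_act_le {A B : Matrix ι ι ℝ} (hA : A.PosDef) (hB : B.PosDef)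
    (p q : PiLp 2 (fun _ : ι => E)) :
    ⟪act (B - A) p, p⟫_ℝ - ⟪act (B - A) q, q⟫_ℝ
      ≤ (B.trace + A.trace) * (‖p‖ + ‖q‖) * ‖p - q‖ := by
  have hD : ∀ u : PiLp 2 (fun _ : ι => E), ‖act (B - A) u‖ ≤ (B.trace + A.trace) * ‖u‖ := by
    intro u
    rw [map_sub, LinearMap.sub_apply, add_mul]
    exact (norm_sub_le _ _).trans
      (add_le_add (norm_act_le_trace hB.posSemidef u) (norm_act_le_trace hA.posSemidef u))
  have h1 : ⟪act (B - A) p, p⟫_ℝ - ⟪act (B - A) q, q⟫_ℝ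
      = ⟪act (B - A) (p - q), p⟫_ℝ + ⟪act (B - A) q, p - q⟫_ℝ := by
    rw [map_sub (act (B - A)) p q, inner_sub_left, inner_sub_right]; ring
  rw [h1]
  calc _ ≤ ‖act (B - A) (p - q)‖ * ‖p‖ + ‖act (B - A) q‖ * ‖p - q‖ :=
        add_le_add (real_inner_le_norm _ _) (real_inner_le_norm _ _)
    _ ≤ (B.trace + A.trace) * ‖p - q‖ * ‖p‖ + (B.trace + A.trace) * ‖q‖ * ‖p - q‖ := by
        gcongr
        · exact hD _
        · exact hD _
    _ = _ := by ring

namespace PenalizedRisk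

variable (F : PenalizedRisk ι E)

theorem matPenalty_convex {A B : Matrix ι ι ℝ} (hA : A.PosDef) (hB : B.PosDef) {a b : ℝ}
    (ha : 0 < a) (hb : 0 < b) (hab : a + b = 1) :
    F.matPenalty (a • A + b • B) ≤ a * F.matPenalty A + b * F.matPenalty B := by
  have h1 := invForm_convex hA hB ha hb hab (idFamily ι)
  simp only [invForm_idFamily] at h1
  have h2 := F.sparsity_add_le ha.le hb.le A B
  have h3 := mul_le_mul_of_nonneg_left h1 F.eps_pos.le
  simp only [matPenalty]
  linarith

/-- First-order condition of the supervised step: `-2 λ A⁻¹ w` is a subgradient of the risk at `w`.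
Compare with `w + t (g - w)`, divide by `t` and let `t` decrease to 0. -/
theorem risk_sub_inner_le {w : PiLp 2 (fun _ : ι => E)} {A : Matrix ι ι ℝ} (hA : A.PosDef)
    (hmin : ∀ g, F.value (w, A) ≤ F.value (g, A)) (g : PiLp 2 (fun _ : ι => E)) :
    F.risk w - 2 * F.lam * ⟪g - w, act A⁻¹ w⟫_ℝ ≤ F.risk g := by
  have key : 0 ≤ F.risk g - F.risk w + 2 * F.lam * ⟪g - w, act A⁻¹ w⟫_ℝ := by
    refine nonneg_of_tendsto_of_small (φ := fun t => F.risk g - F.risk w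
      + 2 * F.lam * ⟪g - w, act A⁻¹ w⟫_ℝ + t * (F.lam * invForm (g - w) A)) ?_ ?_
    · intro t ht ht1
      have h1 := hmin (w + t • (g - w))
      have h2 := F.convexOn_risk.2 (Set.mem_univ w) (Set.mem_univ g)
        (sub_nonneg.mpr ht1.le) ht.le (sub_add_cancel 1 t)
      rw [show (1 - t) • w + t • g = w + t • (g - w) by rw [smul_sub, sub_smul, one_smul]; abel,
        smul_eq_mul, smul_eq_mul] at h2
      simp only [value, invForm_add_smul hA] at h1
      refine nonneg_of_mul_nonneg_right (a := t) ?_ ht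
      nlinarith
    · refine tendsto_nhdsWithin_of_tendsto_nhds ?_
      refine (Continuous.tendsto' (by fun_prop) _ _ (by simp))
  linarith

/-- First-order condition of the unsupervised step: the derivative of `⟨w, A⁻¹ w⟩` in direction `B -
A` is `-⟨(B - A) p, p⟩` with `p = A⁻¹ w`. -/
theorem matPenalty_add_inner_le {w : PiLp 2 (fun _ : ι => E)} {A : Matrix ι ι ℝ} (hA : A.PosDef)
    (hmin : ∀ B : Matrix ι ι ℝ, B.PosDef → F.value (w, A) ≤ F.value (w, B))
    {B : Matrix ι ι ℝ} (hB : B.PosDef) :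
    F.matPenalty A + ⟪act (B - A) (act A⁻¹ w), act A⁻¹ w⟫_ℝ ≤ F.matPenalty B := by
  have hpath : Tendsto (fun t : ℝ => (1 - t) • A + t • B) (𝓝[>] 0) (𝓝 A) := by
    refine tendsto_nhdsWithin_of_tendsto_nhds ?_
    exact Continuous.tendsto' (by fun_prop) _ _ (by simp)
  have hinv : Tendsto (fun t : ℝ => act ((1 - t) • A + t • B)⁻¹ w) (𝓝[>] 0) (𝓝 (act A⁻¹ w)) :=
    tendsto_act ((continuousAt_inv_of_posDef hA).tendsto.comp hpath) tendsto_const_nhds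
  have key : 0 ≤ F.matPenalty B - F.matPenalty A
      - ⟪act (B - A) (act A⁻¹ w), act A⁻¹ w⟫_ℝ := by
    refine nonneg_of_tendsto_of_small (φ := fun t => F.matPenalty B - F.matPenalty A
      - ⟪act (B - A) (act ((1 - t) • A + t • B)⁻¹ w), act ((1 - t) • A + t • B)⁻¹ w⟫_ℝ) ?_ ?_
    · intro t ht ht1
      have hM : ((1 - t) • A + t • B).PosDef :=
        (hA.smul (sub_pos.mpr ht1)).add (hB.smul ht)
      have h1 := hmin _ hM
      have h2 := F.matPenalty_convex hA hB (sub_pos.mpr ht1) ht (sub_add_cancel 1 t)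
      set M := (1 - t) • A + t • B with hMdef
      -- Testing the variational formula for `A` with the maximizer for `M` bounds the increment of
      -- `invForm` without differentiating the inverse; only its continuity is needed as `t → 0`.
      have h3 := le_invForm hA w (act M⁻¹ w)
      have h4 : invForm w M = 2 * ⟪w, act M⁻¹ w⟫_ℝ - ⟪act M (act M⁻¹ w), act M⁻¹ w⟫_ℝ := by
        rw [invForm_eq hM w (act M⁻¹ w)]; simp
      have h5 : ⟪act M (act M⁻¹ w), act M⁻¹ w⟫_ℝ = ⟪act A (act M⁻¹ w), act M⁻¹ w⟫_ℝ
          + t * ⟪act (B - A) (act M⁻¹ w), act M⁻¹ w⟫_ℝ := by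
        have : M = A + t • (B - A) := by
          rw [hMdef, smul_sub, sub_smul, one_smul]; abel
        nth_rewrite 1 [this]
        simp only [map_add, map_smul, LinearMap.add_apply, LinearMap.smul_apply, inner_add_left,
          real_inner_smul_left]
      simp only [value, add_le_add_iff_left] at h1
      have h6 := le_of_mul_le_mul_left h1 F.lam_pos
      refine nonneg_of_mul_nonneg_right (a := t) ?_ ht
      nlinarith
    · exact tendsto_const_nhds.sub ((tendsto_act tendsto_const_nhds hinv).inner hinv)
  linarith

/-- Add the two subgradient inequalities to the variational bound for `⟨g, B⁻¹ g⟩` at `p' = A⁻¹ w'`.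
All terms cancel except that the matrix condition involves `p = A⁻¹ w` instead of `p'`. -/
theorem value_le_add_of_steps {w w' : PiLp 2 (fun _ : ι => E)} {A : Matrix ι ι ℝ} (hA : A.PosDef)
    (hsup : ∀ g, F.value (w', A) ≤ F.value (g, A))
    (hunsup : ∀ B : Matrix ι ι ℝ, B.PosDef → F.value (w, A) ≤ F.value (w, B))
    (g : PiLp 2 (fun _ : ι => E)) {B : Matrix ι ι ℝ} (hB : B.PosDef) :
    F.value (w', A) ≤ F.value (g, B) + F.lam *
      ((B.trace + A.trace) * (‖act A⁻¹ w'‖ + ‖act A⁻¹ w‖) * ‖act A⁻¹ (w' - w)‖) := by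
  have h1 := F.risk_sub_inner_le hA hsup g
  have h2 := F.matPenalty_add_inner_le hA hunsup hB
  have h3 := le_invForm hB g (act A⁻¹ w')
  have h4 : invForm w' A = 2 * ⟪w', act A⁻¹ w'⟫_ℝ - ⟪act A (act A⁻¹ w'), act A⁻¹ w'⟫_ℝ := by
    rw [invForm_eq hA w' (act A⁻¹ w')]; simp
  have h5 := inner_act_sub_inner_act_le hA hB (act A⁻¹ w') (act A⁻¹ w)
  rw [← map_sub (act A⁻¹)] at h5
  have h6 : ⟪act (B - A) (act A⁻¹ w'), act A⁻¹ w'⟫_ℝ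
      = ⟪act B (act A⁻¹ w'), act A⁻¹ w'⟫_ℝ - ⟪act A (act A⁻¹ w'), act A⁻¹ w'⟫_ℝ := by
    rw [map_sub, LinearMap.sub_apply, inner_sub_left]
  rw [inner_sub_left] at h1
  have h7 : F.lam * (invForm w' A + F.matPenalty A) ≤ F.lam * (invForm g B + F.matPenalty B
      + (B.trace + A.trace) * (‖act A⁻¹ w'‖ + ‖act A⁻¹ w‖) * ‖act A⁻¹ (w' - w)‖
      - 2 * (⟪g, act A⁻¹ w'⟫_ℝ - ⟪w', act A⁻¹ w'⟫_ℝ)) :=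
    mul_le_mul_of_nonneg_left (by linarith) F.lam_pos.le
  simp only [value]
  linarith

/-- The exact quadratic expansion of `invForm` at the minimizer `w'` leaves its second-order term as
guaranteed decrease. -/
theorem lam_mul_invForm_sub_le {w w' : PiLp 2 (fun _ : ι => E)} {A : Matrix ι ι ℝ}
    (hA : A.PosDef) (hsup : ∀ g, F.value (w', A) ≤ F.value (g, A)) :
    F.lam * invForm (w' - w) A ≤ F.value (w, A) - F.value (w', A) := by
  have h1 := F.risk_sub_inner_le hA hsup w
  have h2 := invForm_add_smul hA w' (w - w') 1
  have h3 : invForm (w' - w) A = invForm (w - w') A := by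
    rw [← neg_sub w w', invForm, invForm, map_neg, inner_neg_neg]
  rw [one_smul, add_sub_cancel] at h2
  rw [h3]
  simp only [value, h2]
  linarith

/-- The values along an alternating minimization tend to the minimum. -/
theorem tendsto_value_of_alternating {w : ℕ → PiLp 2 (fun _ : ι => E)} {A : ℕ → Matrix ι ι ℝ}
    (hA : ∀ i, (A i).PosDef) (hsup : ∀ i g, F.value (w (i + 1), A i) ≤ F.value (g, A i))
    (hunsup : ∀ i (B : Matrix ι ι ℝ), B.PosDef → F.value (w i, A i) ≤ F.value (w i, B))
    {z₀ : PiLp 2 (fun _ : ι => E) × Matrix ι ι ℝ} (hz₀ : z₀.2.PosDef)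
    (hmin : ∀ z : PiLp 2 (fun _ : ι => E) × Matrix ι ι ℝ, z.2.PosDef → F.value z₀ ≤ F.value z) :
    Tendsto (fun i => F.value (w i, A i)) atTop (𝓝 (F.value z₀)) := by
  have hlam := F.lam_pos
  have heps := F.eps_pos
  have hstep : ∀ i, F.value (w (i + 1), A (i + 1)) ≤ F.value (w (i + 1), A i) :=
    fun i => hunsup (i + 1) _ (hA i)
  have hanti : Antitone fun i => F.value (w i, A i) :=
    antitone_nat_of_succ_le fun i => (hstep i).trans (hsup i _)
  have hbdd : BddBelow (Set.range fun i => F.value (w i, A i)) :=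
    ⟨F.value z₀, by rintro _ ⟨i, rfl⟩; exact hmin _ (hA i)⟩
  have hconv := tendsto_atTop_ciInf hanti hbdd
  have hdiff : Tendsto (fun i => F.value (w i, A i) - F.value (w (i + 1), A (i + 1))) atTop
      (𝓝 0) := by
    simpa using hconv.sub ((tendsto_add_atTop_iff_nat 1).mpr hconv)
  set b := F.value (w 0, A 0) with hbdef
  have hb : ∀ i, F.value (w i, A i) ≤ b := fun i => hanti (Nat.zero_le i)
  have hb0 : 0 ≤ b := F.value_nonneg (hA 0)
  set c := b / (F.lam * F.eps) with hc
  set d := b / F.lam with hd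
  have hc0 : 0 ≤ c := by positivity
  have hd0 : 0 ≤ d := by positivity
  have hic : ∀ i, (A i)⁻¹.trace ≤ c := fun i =>
    (F.trace_inv_le (z := (w i, A i)) (hA i)).trans
      (div_le_div_of_nonneg_right (hb i) (by positivity))
  have htr : ∀ i, (A i).trace ≤ d := fun i =>
    (F.trace_le (z := (w i, A i)) (hA i)).trans (div_le_div_of_nonneg_right (hb i) hlam.le)
  have hnorm : ∀ i v, F.value (v, A i) ≤ b → ‖act (A i)⁻¹ v‖ ≤ √(c * d) := by
    intro i v hv
    refine Real.le_sqrt_of_sq_le ((norm_act_inv_sq_le (hA i) v).trans ?_)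
    refine mul_le_mul (hic i) ?_ (invForm_nonneg (hA i) v) hc0
    exact (F.invForm_le (z := (v, A i)) (hA i)).trans (div_le_div_of_nonneg_right hv hlam.le)
  have hsmall : ∀ i, ‖act (A i)⁻¹ (w (i + 1) - w i)‖ ≤
      √(c / F.lam * (F.value (w i, A i) - F.value (w (i + 1), A (i + 1)))) := by
    intro i
    refine Real.le_sqrt_of_sq_le ((norm_act_inv_sq_le (hA i) _).trans ?_)
    have h1 := F.lam_mul_invForm_sub_le (w := w i) (hA i) (hsup i)
    have h2 : invForm (w (i + 1) - w i) (A i) ≤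
        (F.value (w i, A i) - F.value (w (i + 1), A (i + 1))) / F.lam := by
      rw [le_div_iff₀' hlam]
      linarith [hstep i]
    rw [div_mul_eq_mul_div, mul_div_assoc]
    exact mul_le_mul (hic i) h2 (invForm_nonneg (hA i) _) hc0
  set K := F.lam * ((z₀.2.trace + d) * (√(c * d) + √(c * d))) with hK
  have hupper : ∀ i, F.value (w (i + 1), A (i + 1)) ≤ F.value z₀ +
      K * √(c / F.lam * (F.value (w i, A i) - F.value (w (i + 1), A (i + 1)))) := by
    intro i
    refine (hstep i).trans
      ((F.value_le_add_of_steps (hA i) (hsup i) (hunsup i) z₀.1 hz₀).trans ?_)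
    have h0 := hz₀.posSemidef.trace_nonneg
    rw [hK, mul_assoc F.lam]
    gcongr
    · exact htr i
    · exact hnorm i _ ((hsup i _).trans (hb i))
    · exact hnorm i _ (hb i)
    · exact hsmall i
  have herr : Tendsto (fun i => F.value z₀ +
      K * √(c / F.lam * (F.value (w i, A i) - F.value (w (i + 1), A (i + 1))))) atTop
      (𝓝 (F.value z₀)) := by
    have := ((Real.continuous_sqrt.tendsto _).comp (hdiff.const_mul (c / F.lam))).const_mul K
    simpa using this.const_add (F.value z₀)
  refine (tendsto_add_atTop_iff_nat 1).mp ?_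
  exact tendsto_of_tendsto_of_tendsto_of_le_of_le tendsto_const_nhds herr
    (fun i => hmin _ (hA (i + 1))) hupper

end PenalizedRisk

end Alternation

/-! ### Identification of the spaces with kernel `k A` with coefficients in the feature space. -/

section Transfer

/-- Two families with the same Gram matrix, the first of them total: every vector of the first space
has a counterpart in the second one with the same norm and the same inner products. -/
theorem exists_inner_eq_of_gram_eq {I G H : Type*} [NormedAddCommGroup G] [InnerProductSpace ℝ G]
    [NormedAddCommGroup H] [InnerProductSpace ℝ H] [CompleteSpace G] [CompleteSpace H]
    {a : I → G} {b : I → H} (hgram : ∀ i j, ⟪a i, a j⟫_ℝ = ⟪b i, b j⟫_ℝ)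
    (htotal : ∀ u, (∀ i, ⟪u, a i⟫_ℝ = 0) → u = 0) (u : G) :
    ∃ v : H, (∀ i, ⟪v, b i⟫_ℝ = ⟪u, a i⟫_ℝ) ∧ ‖v‖ = ‖u‖ := by
  have hinner : ∀ c c' : I →₀ ℝ,
      ⟪Finsupp.linearCombination ℝ a c, Finsupp.linearCombination ℝ a c'⟫_ℝ
        = ⟪Finsupp.linearCombination ℝ b c, Finsupp.linearCombination ℝ b c'⟫_ℝ := by
    intro c c'
    simp only [Finsupp.linearCombination_apply, Finsupp.sum_inner, Finsupp.inner_sum,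
      real_inner_smul_left, real_inner_smul_right, hgram]
  have hnorm : ∀ c : I →₀ ℝ,
      ‖Finsupp.linearCombination ℝ b c‖ = ‖Finsupp.linearCombination ℝ a c‖ := by
    intro c
    rw [norm_eq_sqrt_real_inner, norm_eq_sqrt_real_inner, hinner]
  have hdense : (Submodule.span ℝ (Set.range a)).topologicalClosure = ⊤ := by
    rw [Submodule.topologicalClosure_eq_top_iff, Submodule.eq_bot_iff]
    intro x hx
    refine htotal x fun i => ?_
    exact (Submodule.mem_orthogonal' _ _).mp hx _ (Submodule.subset_span ⟨i, rfl⟩)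
  have hu : u ∈ closure (Submodule.span ℝ (Set.range a) : Set G) := by
    rw [← Submodule.topologicalClosure_coe, hdense]
    trivial
  obtain ⟨x, hx, hxu⟩ := mem_closure_iff_seq_limit.mp hu
  simp only [SetLike.mem_coe, ← Finsupp.range_linearCombination, LinearMap.mem_range] at hx
  choose c hc using hx
  -- The same coefficients give the same distances in both spaces, so approximants of `u` carry
  -- over.
  have hcauchy : CauchySeq fun i => Finsupp.linearCombination ℝ b (c i) := by
    have h := hxu.cauchySeq
    rw [Metric.cauchySeq_iff] at h ⊢
    simpa only [dist_eq_norm, ← map_sub, hnorm, ← hc] using h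
  obtain ⟨v, hv⟩ := cauchySeq_tendsto_of_complete hcauchy
  refine ⟨v, fun i => ?_, ?_⟩
  · refine tendsto_nhds_unique (hv.inner tendsto_const_nhds)
      ((hxu.inner tendsto_const_nhds).congr fun j => ?_)
    rw [← hc]
    simpa using hinner (c j) (Finsupp.single i 1)
  · refine tendsto_nhds_unique hv.norm (hxu.norm.congr fun j => ?_)
    rw [hnorm, hc]

variable {X : Type*} {T : ℕ} (k : ScalarKernel X)

/-- A Hilbert space carrying a total feature map of the scalar kernel `k`. -/
abbrev FeatureSpace := Hyp k (PDMatrix.id 1)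

/-- The canonical feature map of the scalar kernel `k`. -/
def feature (x : X) : FeatureSpace k :=
  RKHS.kerFun (FeatureSpace k) x (EuclideanSpace.single 0 1)

theorem inner_feature (x y : X) : ⟪feature k x, feature k y⟫_ℝ = k.1 y x := by
  rw [feature, feature, ← RKHS.kernel_inner, kernel_hyp]
  simp [separableKernel, PDMatrix.id, real_inner_smul_left]

theorem eq_zero_of_inner_feature {u : FeatureSpace k} (h : ∀ x, ⟪u, feature k x⟫_ℝ = 0) :
    u = 0 := by
  refine RKHS.ext fun x => ?_
  have hx := h x
  rw [feature, RKHS.inner_kerFun] at hx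
  ext t
  rw [Subsingleton.elim t 0]
  simpa [EuclideanSpace.inner_single_right] using hx

variable (T) in
/-- The space of `T`-tuples of elements of the feature space. -/
abbrev CoeffSpace := PiLp 2 (fun _ : Fin T => FeatureSpace k)

/-- The function `x ↦ (⟨w_t, φ(x)⟩)_t`. -/
def featureFun : CoeffSpace T k →ₗ[ℝ] X → Out T where
  toFun w x := WithLp.toLp 2 fun t => ⟪w t, feature k x⟫_ℝ
  map_add' w v := by ext x t; simp [inner_add_left]
  map_smul' c w := by ext x t; simp [real_inner_smul_left]

/-- The elementary tensor `v ⊗ φ(x)`. -/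
def tensorFeature (v : Out T) (x : X) : CoeffSpace T k :=
  WithLp.toLp 2 fun t => v t • feature k x

theorem inner_tensorFeature (w : CoeffSpace T k) (v : Out T) (x : X) :
    ⟪w, tensorFeature k v x⟫_ℝ = ⟪featureFun k w x, v⟫_ℝ := by
  simp [PiLp.inner_apply, tensorFeature, featureFun, real_inner_smul_right]

theorem featureFun_injective : Function.Injective (featureFun (T := T) k) := by
  refine (injective_iff_map_eq_zero _).mpr fun w hw => ?_
  ext t : 1
  refine eq_zero_of_inner_feature k fun x => ?_
  exact congrArg (fun f : X → Out T => f x t) hw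

theorem continuous_featureFun_apply (x : X) :
    Continuous fun w : CoeffSpace T k => featureFun k w x := by
  refine (PiLp.continuous_toLp 2 (fun _ : Fin T => ℝ)).comp (continuous_pi fun t => ?_)
  exact (PiLp.continuous_apply 2 _ t).inner continuous_const

/-- With `A = Dᵀ D`, this says that the kernel sections and the vectors `D (v ⊗ φ(x))` have the same
Gram matrix, as `exists_inner_eq_of_gram_eq` requires. -/
theorem inner_kerFun_kerFun (A : PDMatrix T) (x y : X) (v w : Out T) :
    ⟪RKHS.kerFun (Hyp k A) x v, RKHS.kerFun (Hyp k A) y w⟫_ℝ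
      = ⟪act A.1 (tensorFeature k v x), tensorFeature k w y⟫_ℝ := by
  rw [← RKHS.kernel_inner, kernel_hyp, inner_tensorFeature]
  have h : featureFun k (act A.1 (tensorFeature k v x)) y
      = k.1 y x • Matrix.toEuclideanCLM (n := Fin T) (𝕜 := ℝ) A.1 v := by
    ext t
    simp [featureFun, tensorFeature, sum_inner, real_inner_smul_left, inner_feature,
      Matrix.mulVec, dotProduct, Finset.mul_sum]
    exact Finset.sum_congr rfl fun s _ => by ring
  rw [h]
  simp [separableKernel]

/-- The elements of the space with kernel `k A` are the functions `featureFun k w`, the squared norm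
being `⟨w, A⁻¹ w⟩`. -/
theorem exists_hyp_eq_featureFun (A : PDMatrix T) (w : CoeffSpace T k) :
    ∃ g : Hyp k A, ⇑g = featureFun k w ∧ ‖g‖ ^ 2 = invForm w A.1 := by
  obtain ⟨D, hD⟩ := exists_transpose_mul_self_eq A.2.posSemidef
  have hdet : IsUnit D.det := by
    have h := (Matrix.isUnit_iff_isUnit_det _).mp A.2.isUnit
    rw [hD, Matrix.det_mul] at h
    exact isUnit_of_mul_isUnit_right h
  have hdet' : IsUnit Dᵀ.det := by rwa [Matrix.det_transpose]
  set u := act (Dᵀ)⁻¹ w with hu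
  have hDu : act Dᵀ u = w := by rw [hu, ← act_mul, Matrix.mul_nonsing_inv _ hdet', act_one]
  obtain ⟨g, hg, hgu⟩ := exists_inner_eq_of_gram_eq
    (a := fun p : X × Out T => act D (tensorFeature k p.2 p.1))
    (b := fun p : X × Out T => RKHS.kerFun (Hyp k A) p.1 p.2)
    (fun p q => by
      rw [inner_kerFun_kerFun, hD, act_mul, inner_act Dᵀ, Matrix.transpose_transpose])
    -- Totality: a vector `v` orthogonal to the family has `featureFun k (Dᵀ v) = 0`, and both
    -- `featureFun` and `Dᵀ` are injective.
    (fun v hv => by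
      have h : featureFun k (act Dᵀ v) = featureFun k 0 := by
        funext x
        refine ext_inner_right ℝ fun y => ?_
        rw [← inner_tensorFeature, inner_act, Matrix.transpose_transpose, hv (x, y), map_zero]
        simp
      have h' := featureFun_injective k h
      have : act (Dᵀ)⁻¹ (act Dᵀ v) = 0 := by rw [h', map_zero]
      rwa [← act_mul, Matrix.nonsing_inv_mul _ hdet', act_one] at this) u
  refine ⟨g, ?_, ?_⟩
  · funext x
    refine ext_inner_right ℝ fun y => ?_
    have h := hg (x, y)
    rw [RKHS.inner_kerFun] at h
    rw [h, ← inner_tensorFeature, ← hDu, inner_act Dᵀ u, Matrix.transpose_transpose]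
  · rw [hgu, ← real_inner_self_eq_norm_sq, hu, inner_act, ← act_mul, invForm,
      Matrix.transpose_nonsing_inv, Matrix.transpose_transpose, ← Matrix.mul_inv_rev, ← hD]

theorem exists_featureFun_eq_hyp (A : PDMatrix T) (g : Hyp k A) :
    ∃ w : CoeffSpace T k, featureFun k w = ⇑g := by
  obtain ⟨D, hD⟩ := exists_transpose_mul_self_eq A.2.posSemidef
  obtain ⟨u, hu, -⟩ := exists_inner_eq_of_gram_eq
    (a := fun p : X × Out T => RKHS.kerFun (Hyp k A) p.1 p.2)
    (b := fun p : X × Out T => act D (tensorFeature k p.2 p.1))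
    (fun p q => by
      rw [inner_kerFun_kerFun, hD, act_mul, inner_act Dᵀ, Matrix.transpose_transpose])
    (fun v hv => by
      refine RKHS.ext fun x => ext_inner_right ℝ fun y => ?_
      rw [← RKHS.inner_kerFun, hv (x, y)]
      simp) g
  refine ⟨act Dᵀ u, ?_⟩
  funext x
  refine ext_inner_right ℝ fun y => ?_
  rw [← inner_tensorFeature, inner_act, Matrix.transpose_transpose, hu (x, y), RKHS.inner_kerFun]

/-- The right side does not involve `A`: this decouples the constraints on `f` and `A`. -/
theorem memHyp_iff (A : PDMatrix T) (f : X → Out T) :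
    MemHyp k A f ↔ ∃ w : CoeffSpace T k, featureFun k w = f := by
  constructor
  · rintro ⟨g, rfl⟩
    exact exists_featureFun_eq_hyp k A g
  · rintro ⟨w, rfl⟩
    obtain ⟨g, hg, -⟩ := exists_hyp_eq_featureFun k A w
    exact ⟨g, hg⟩

theorem norm_sq_eq_invForm {A : PDMatrix T} {g : Hyp k A} {w : CoeffSpace T k}
    (h : ⇑g = featureFun k w) : ‖g‖ ^ 2 = invForm w A.1 := by
  obtain ⟨g', hg', hnorm⟩ := exists_hyp_eq_featureFun k A w
  rw [DFunLike.coe_injective (h.trans hg'.symm), hnorm]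

theorem hypNorm_featureFun_sq (A : PDMatrix T) (w : CoeffSpace T k) :
    hypNorm k A (featureFun k w) ^ 2 = invForm w A.1 := by
  obtain ⟨g, hg, hnorm⟩ := exists_hyp_eq_featureFun k A w
  rw [← hg, hypNorm_coe, hnorm]

theorem tendstoHyp_featureFun (A : PDMatrix T) {w : ℕ → CoeffSpace T k} {w₀ : CoeffSpace T k}
    (hw : Tendsto w atTop (𝓝 w₀)) :
    TendstoHyp k A (fun i => featureFun k (w i)) (featureFun k w₀) := by
  choose g hg _ using fun v : CoeffSpace T k => exists_hyp_eq_featureFun k A v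
  refine ⟨fun i => g (w i), g w₀, fun i => hg _, hg _, ?_⟩
  have h1 : ∀ i, ‖g (w i) - g w₀‖ ^ 2 = invForm (w i - w₀) A.1 := fun i =>
    norm_sq_eq_invForm k (by rw [RKHS.coe_sub, hg, hg, map_sub])
  have h2 : Tendsto (fun i => invForm (w i - w₀) A.1) atTop (𝓝 0) := by
    have := tendsto_invForm A.2 tendsto_const_nhds (hw.sub_const w₀)
    simpa [invForm] using this
  rw [tendsto_iff_norm_sub_tendsto_zero]
  have h3 := (Real.continuous_sqrt.tendsto 0).comp h2
  rw [Real.sqrt_zero] at h3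
  refine h3.congr fun i => ?_
  rw [Function.comp_apply, ← h1, Real.sqrt_sq (norm_nonneg _)]

namespace Problem

variable {n : ℕ} (P : Problem X n T)

/-- The reduction of a Sparse Kernel MTL problem to coefficients in the feature space. -/
def penalizedRisk (hV_nonneg : ∀ y z, 0 ≤ P.V y z)
    (hV_convex : ∀ y, ConvexOn ℝ Set.univ (P.V y))
    (hlam : 0 < P.lam) (heps : 0 < P.eps) (hmu : P.mu ∈ Set.Icc (0 : ℝ) 1) :
    PenalizedRisk (Fin T) (FeatureSpace P.k) where
  risk w := (1 / (n : ℝ)) * ∑ i, P.V (P.y i) (featureFun P.k w (P.x i))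
  risk_nonneg w := mul_nonneg (by positivity) (Finset.sum_nonneg fun i _ => hV_nonneg _ _)
  convexOn_risk := by
    refine ⟨convex_univ, fun w _ v _ a b ha hb hab => ?_⟩
    have h : ∀ i, P.V (P.y i) (featureFun P.k (a • w + b • v) (P.x i)) ≤
        a * P.V (P.y i) (featureFun P.k w (P.x i)) + b * P.V (P.y i) (featureFun P.k v (P.x i)) := by
      intro i
      rw [map_add, map_smul, map_smul]
      exact (hV_convex (P.y i)).2 (Set.mem_univ _) (Set.mem_univ _) ha hb hab
    have h' := mul_le_mul_of_nonneg_left (Finset.sum_le_sum fun i (_ : i ∈ Finset.univ) => h i)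
      (by positivity : (0 : ℝ) ≤ 1 / n)
    rw [Finset.sum_add_distrib, ← Finset.mul_sum, ← Finset.mul_sum] at h'
    refine h'.trans_eq ?_
    simp only [smul_eq_mul]
    ring
  continuous_risk := by
    refine continuous_const.mul (continuous_finsetSum _ fun i _ => ?_)
    -- A finite convex function on a finite-dimensional space is continuous.
    have h : Continuous (P.V (P.y i)) :=
      continuousOn_univ.mp ((hV_convex (P.y i)).continuousOn isOpen_univ)
    exact h.comp (continuous_featureFun_apply P.k (P.x i))
  lam := P.lam
  lam_pos := hlam
  eps := P.eps
  eps_pos := heps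
  mu := P.mu
  mu_mem := hmu

theorem mem_feasible_iff (p : (X → Out T) × PDMatrix T) :
    p ∈ P.feasible ↔ ∃ w : CoeffSpace T P.k, featureFun P.k w = p.1 :=
  memHyp_iff P.k p.2 p.1

end Problem

/-! ### The alternating scheme expressed in coefficients. -/

section Reduction

variable {n : ℕ} {P : Problem X n T} {F : PenalizedRisk (Fin T) (FeatureSpace P.k)}

/-- Well-posedness on the slice of fixed matrix; the unsupervised step uses the slice of fixed
coefficients. -/
theorem exists_unique_supervisedStep
    (hF : ∀ w A, P.objective (featureFun P.k w, A) = F.value (w, A.1)) (A : PDMatrix T) :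
    ∃! f, P.IsSupervisedStep A f := by
  have hconv : Convex ℝ {z : CoeffSpace T P.k × Matrix (Fin T) (Fin T) ℝ | z.2 = A.1} :=
    (convex_singleton A.1).is_linear_preimage (f := Prod.snd) ⟨fun _ _ => rfl, fun _ _ => rfl⟩
  obtain ⟨⟨w, B⟩, hB, hpd, hmin, -⟩ := F.exists_minimizer hconv
    (isClosed_eq continuous_snd continuous_const) ⟨(0, A.1), rfl, A.2⟩
  obtain rfl : B = A.1 := hB
  refine ⟨featureFun P.k w, ⟨(P.mem_feasible_iff _).mpr ⟨w, rfl⟩, fun g hg => ?_⟩,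
    fun g hg => ?_⟩
  · obtain ⟨v, rfl⟩ := (P.mem_feasible_iff _).mp hg
    rw [hF, hF]
    exact hmin (v, A.1) rfl A.2
  · obtain ⟨v, rfl⟩ := (P.mem_feasible_iff _).mp hg.1
    have h1 := hg.2 (featureFun P.k w) ((P.mem_feasible_iff _).mpr ⟨w, rfl⟩)
    rw [hF, hF] at h1
    have h2 := F.eq_of_minimizers hconv hmin (z := (v, A.1)) (z' := (w, A.1)) rfl rfl A.2 A.2
      (le_antisymm h1 (hmin (v, A.1) rfl A.2)) rfl
    exact congrArg (featureFun P.k) (Prod.ext_iff.mp h2).1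

theorem exists_unique_unsupervisedStep
    (hF : ∀ w A, P.objective (featureFun P.k w, A) = F.value (w, A.1))
    (w : CoeffSpace T P.k) : ∃! A, P.IsUnsupervisedStep (featureFun P.k w) A := by
  have hconv : Convex ℝ {z : CoeffSpace T P.k × Matrix (Fin T) (Fin T) ℝ | z.1 = w} :=
    (convex_singleton w).is_linear_preimage (f := Prod.fst) ⟨fun _ _ => rfl, fun _ _ => rfl⟩
  obtain ⟨⟨v, A⟩, hv, hpd, hmin, -⟩ := F.exists_minimizer hconv
    (isClosed_eq continuous_fst continuous_const) ⟨(w, 1), rfl, Matrix.PosDef.one⟩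
  obtain rfl : v = w := hv
  have hfeas : ∀ B, (featureFun P.k v, B) ∈ P.feasible :=
    fun B => (P.mem_feasible_iff _).mpr ⟨v, rfl⟩
  refine ⟨⟨A, hpd⟩, ⟨hfeas _, fun B _ => ?_⟩, fun B hB => ?_⟩
  · rw [hF, hF]
    exact hmin (v, B.1) rfl B.2
  · have h1 := hB.2 ⟨A, hpd⟩ (hfeas _)
    rw [hF, hF] at h1
    have h2 := F.eq_of_minimizers hconv hmin (z := (v, B.1)) (z' := (v, A)) rfl rfl B.2 hpd
      (le_antisymm h1 (hmin (v, B.1) rfl B.2)) rfl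
    exact Subtype.ext (Prod.ext_iff.mp h2).2

theorem exists_unique_alternatingMinimization
    (hF : ∀ w A, P.objective (featureFun P.k w, A) = F.value (w, A.1)) :
    ∃! s, P.IsAlternatingMinimization s := by
  choose f hf hf' using fun A => exists_unique_supervisedStep hF A
  have hstep : ∀ A, ∃! B, P.IsUnsupervisedStep (f A) B := by
    intro A
    obtain ⟨w, hw⟩ := (P.mem_feasible_iff _).mp (hf A).1
    rw [show f A = featureFun P.k w from hw.symm]
    exact exists_unique_unsupervisedStep hF w
  choose B hB hB' using hstep
  let s : ℕ → (X → Out T) × PDMatrix T :=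
    fun i => Nat.rec (0, PDMatrix.id T) (fun _ p => (f p.2, B p.2)) i
  refine ⟨s, ⟨rfl, fun i => hf _, fun i => hB _⟩, fun r hr => ?_⟩
  funext i
  induction i with
  | zero => exact hr.init
  | succ i ih =>
    have h1 : (r (i + 1)).1 = f (s i).2 := by
      rw [← ih]
      exact hf' _ _ (hr.supervised i)
    refine Prod.ext h1 ?_
    have h2 := hr.unsupervised i
    rw [h1] at h2
    exact hB' _ _ h2

theorem alternatingMinimization_mem_feasible {s : ℕ → (X → Out T) × PDMatrix T}
    (hs : P.IsAlternatingMinimization s) (i : ℕ) : s i ∈ P.feasible := by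
  cases i with
  | zero => exact (P.mem_feasible_iff _).mpr ⟨0, by rw [hs.init, map_zero]⟩
  | succ i => exact (hs.unsupervised i).1

theorem tendsto_value_of_alternatingMinimization
    (hF : ∀ w A, P.objective (featureFun P.k w, A) = F.value (w, A.1))
    {s : ℕ → (X → Out T) × PDMatrix T} (hs : P.IsAlternatingMinimization s)
    {w : ℕ → CoeffSpace T P.k} (hw : ∀ i, featureFun P.k (w i) = (s i).1)
    {z₀ : CoeffSpace T P.k × Matrix (Fin T) (Fin T) ℝ} (hz₀ : z₀.2.PosDef)
    (hmin : ∀ z : CoeffSpace T P.k × Matrix (Fin T) (Fin T) ℝ, z.2.PosDef →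
      F.value z₀ ≤ F.value z) :
    Tendsto (fun i => F.value (w i, (s i).2.1)) atTop (𝓝 (F.value z₀)) := by
  -- The initial matrix `I_T` need not be optimal for `f_0 = 0`, so the argument starts at index 1.
  refine (tendsto_add_atTop_iff_nat 1).mp ?_
  refine F.tendsto_value_of_alternating (w := fun i => w (i + 1))
    (A := fun i => (s (i + 1)).2.1) (fun i => (s (i + 1)).2.2) ?_ ?_ hz₀ hmin
  · intro i g
    have h := (hs.supervised (i + 1)).2 (featureFun P.k g) ((P.mem_feasible_iff _).mpr ⟨g, rfl⟩)
    rwa [← hw, hF, hF] at h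
  · intro i B hB
    have h := (hs.unsupervised i).2 ⟨B, hB⟩
      ((P.mem_feasible_iff _).mpr ⟨w (i + 1), hw (i + 1)⟩)
    rwa [← hw, hF, hF] at h

end Reduction

end Transfer

end SparseKernelMTL

end
-- The convergence theorem.
open SparseKernelMTL in
theorem mainTheorem1 {X : Type*} {n T : ℕ} (P : Problem X n T)
    (hV_nonneg : ∀ y z, 0 ≤ P.V y z)
    (hV_convex : ∀ y, ConvexOn ℝ Set.univ (P.V y))
    (hlam : 0 < P.lam) (heps : 0 < P.eps) (hmu : P.mu ∈ Set.Icc (0 : ℝ) 1) :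
    ∃ (f' : X → Out T) (A' : PDMatrix T),
      (P.IsSolution (f', A') ∧ ∀ q, P.IsSolution q → q = (f', A')) ∧
      (∃! s, P.IsAlternatingMinimization s) ∧
      ∀ s, P.IsAlternatingMinimization s →
        P.IsMinimizingSequence s ∧
        (∀ A : PDMatrix T, TendstoHyp P.k A (fun i => (s i).1) f') ∧
        Tendsto (fun i => (s i).2) atTop (𝓝 A') := by
  set F := P.penalizedRisk hV_nonneg hV_convex hlam heps hmu with hFdef
  have hF : ∀ w A, P.objective (featureFun P.k w, A) = F.value (w, A.1) := by
    intro w A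
    simp only [Problem.objective, PenalizedRisk.value, PenalizedRisk.matPenalty,
      PenalizedRisk.sparsity, hFdef, Problem.penalizedRisk, hypNorm_featureFun_sq]
    ring
  obtain ⟨⟨w₀, A₀⟩, -, hpd, hmin, hconv⟩ := F.exists_minimizer convex_univ isClosed_univ
    ⟨(0, 1), Set.mem_univ _, Matrix.PosDef.one⟩
  have hglb : ∀ q ∈ P.feasible, P.objective (featureFun P.k w₀, ⟨A₀, hpd⟩) ≤ P.objective q := by
    rintro ⟨f, B⟩ hq
    obtain ⟨v, rfl⟩ := (P.mem_feasible_iff _).mp hq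
    rw [hF, hF]
    exact hmin (v, B.1) (Set.mem_univ _) B.2
  have hfeas : (featureFun P.k w₀, ⟨A₀, hpd⟩) ∈ P.feasible := (P.mem_feasible_iff _).mpr ⟨w₀, rfl⟩
  refine ⟨featureFun P.k w₀, ⟨A₀, hpd⟩, ⟨⟨hfeas, fun q hq => hglb q hq⟩, ?_⟩,
    exists_unique_alternatingMinimization hF, fun s hs => ?_⟩
  · rintro ⟨f, B⟩ hq
    obtain ⟨v, rfl⟩ := (P.mem_feasible_iff _).mp hq.1
    have h1 := hq.2 hfeas
    rw [Set.mem_ofPred_eq, hF, hF] at h1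
    have h2 := F.eq_of_minimizers convex_univ hmin (z := (v, B.1)) (z' := (w₀, A₀))
      (Set.mem_univ _) (Set.mem_univ _) B.2 hpd
      (le_antisymm h1 (hmin (v, B.1) (Set.mem_univ _) B.2)) rfl
    obtain ⟨rfl, h3⟩ := Prod.ext_iff.mp h2
    exact Prod.ext rfl (Subtype.ext h3)
  · have hmem := alternatingMinimization_mem_feasible hs
    choose w hw using fun i => (P.mem_feasible_iff _).mp (hmem i)
    have hval := tendsto_value_of_alternatingMinimization hF hs hw hpd
      fun z hz => hmin z (Set.mem_univ _) hz
    have hlim := hconv (fun i => (w i, (s i).2.1)) (fun _ => Set.mem_univ _)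
      (fun i => (s i).2.2) hval
    refine ⟨⟨hmem, F.value (w₀, A₀), ?_, ?_⟩, fun A => ?_, ?_⟩
    · rw [← hF w₀ ⟨A₀, hpd⟩]
      refine IsLeast.isGLB ⟨⟨_, hfeas, rfl⟩, ?_⟩
      rintro _ ⟨q, hq, rfl⟩
      exact hglb q hq
    · refine hval.congr fun i => ?_
      rw [← hF, hw]
    · have h := tendstoHyp_featureFun P.k A ((continuous_fst.tendsto _).comp hlim)
      simpa only [Function.comp_apply, hw] using h
    · exact tendsto_subtype_rng.mpr ((continuous_snd.tendsto _).comp hlim)
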